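/- Let $n\ge c\ge 2$ be integers, and let $\delta(n)$ be $0$ if $n$ is even and $1$ if $n$ is odd. Let $N$ be a connected Riemannian $n$-manifold with positive sectional curvature, on which the torus $T^s=(S^1)^s$ acts continuously, effectively and by isometries, with a fixed point $x$. For an involution $\sigma\in T^s$ (an element of order exactly $2$), let $N^\sigma_x$ denote the connected component containing $x$ of the fixed-point set of $\sigma$, and call $\sigma$ *small* if $N^\sigma_x$ is an embedded submanifold of $N$ whose codimension satisfies $$\operatorname{cod} N^\sigma_x\equiv 0 \pmod 4,\qquad 0<\operatorname{cod} N^\sigma_x\le \frac{n-c}{2}.$$ 1. If $s\ge 2\log_2 n+\frac c2-1-\delta(n)$, then there exists a small involution $\sigma\in T^s$. 2. Let $\sigma\in T^s$ be a small involution such that $\operatorname{cod} N^\sigma_x$ is minimal among all small involutions of $T^s$. If $s\ge \log_2 n+\frac c2+1+\log_2 3-\delta(n)$, then there exists a small involution $\tau\in T^s$ with $N^\tau_x\not\subseteq N^\sigma_x$ and $\operatorname{cod}(N^\sigma_x\cap N^\tau_x)\equiv 0\pmod 4$. Here $\operatorname{cod}(N^\sigma_x\cap N^\tau_x)$ is the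 codimension at $x$: there is an integer $m\equiv 0\pmod 4$ such that $N^\sigma_x\cap N^\tau_x$ is an embedded submanifold of codimension $m$ near each point of its connected component containing $x$. -/

import Mathlib

open scoped Manifold ContDiff

noncomputable section

namespace TorusFixedPoints

/-- The model space `ℝⁿ` with its Euclidean structure. -/
abbrev Coord (n : ℕ) : Type := EuclideanSpace ℝ (Fin n)

/-- The torus `T^s = S¹ × ⋯ × S¹`. -/
abbrev Torus (s : ℕ) : Type := Fin s → Circle

/-- A smooth Riemannian metric on the smooth `n`-manifold `N`. -/
abbrev RiemMetric (n : ℕ) (N : Type*) [TopologicalSpace N] [ChartedSpace (Coord n) N]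
    [IsManifold (𝓡 n) ∞ N] : Type _ :=
  Bundle.ContMDiffRiemannianMetric (𝓡 n) ∞ (Coord n) (fun p : N => TangentSpace (𝓡 n) p)

/-! ### Curvature of a metric given by its coefficients on an open set of `ℝⁿ` -/

section Local

variable {n : ℕ}

/-- The partial derivative `∂ᵢ f` at `u`. -/
def partialDeriv (i : Fin n) (f : Coord n → ℝ) (u : Coord n) : ℝ :=
  fderiv ℝ f u (EuclideanSpace.single i 1)

/-- The Christoffel symbol
`Γᵏᵢⱼ = ½ ∑ₗ gᵏˡ (∂ᵢ gⱼₗ + ∂ⱼ gᵢₗ - ∂ₗ gᵢⱼ)` of the metric coefficients `G`. -/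
def christoffel (G : Coord n → Matrix (Fin n) (Fin n) ℝ) (k i j : Fin n) (u : Coord n) : ℝ :=
  (1 / 2) * ∑ l, (G u)⁻¹ k l *
    (partialDeriv i (fun z => G z j l) u + partialDeriv j (fun z => G z i l) u
      - partialDeriv l (fun z => G z i j) u)

/-- The coefficient `Rˡᵢⱼₖ` of the curvature tensor, `R(∂ᵢ, ∂ⱼ) ∂ₖ = ∑ₗ Rˡᵢⱼₖ ∂ₗ`, where
`R(X, Y) Z = ∇_X ∇_Y Z - ∇_Y ∇_X Z - ∇_[X,Y] Z` for the Levi-Civita connection `∇`. -/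
def riemannCoeff (G : Coord n → Matrix (Fin n) (Fin n) ℝ) (l i j k : Fin n) (u : Coord n) : ℝ :=
  partialDeriv i (christoffel G l j k) u - partialDeriv j (christoffel G l i k) u
    + ∑ m, (christoffel G m j k u * christoffel G l i m u
      - christoffel G m i k u * christoffel G l j m u)

/-- The inner product `⟨a, b⟩` at `u` of two vectors given by their coordinates. -/
def coordInner (G : Coord n → Matrix (Fin n) (Fin n) ℝ) (u a b : Coord n) : ℝ :=
  ∑ i, ∑ j, G u i j * a i * b j

/-- The curvature expression `⟨R(a, b) b, a⟩` at `u`. -/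
def curvatureForm (G : Coord n → Matrix (Fin n) (Fin n) ℝ) (u a b : Coord n) : ℝ :=
  ∑ i, ∑ j, ∑ k, ∑ l, ∑ h, riemannCoeff G l i j k u * G u l h * a i * b j * b k * a h

/-- The sectional curvature at `u` of the plane spanned by the linearly independent vectors
`a` and `b`. -/
def coordSectionalCurvature (G : Coord n → Matrix (Fin n) (Fin n) ℝ) (u a b : Coord n) : ℝ :=
  curvatureForm G u a b /
    (coordInner G u a a * coordInner G u b b - coordInner G u a b ^ 2)

end Local

section Manifold

variable {n : ℕ} {N : Type*} [TopologicalSpace N] [ChartedSpace (Coord n) N]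

/-- The coefficients `gᵢⱼ = g(∂ᵢ, ∂ⱼ)` of the metric `g` in the chart `e`, as functions on the
target of the chart. -/
def metricCoeff [IsManifold (𝓡 n) ∞ N] (g : RiemMetric n N)
    (e : OpenPartialHomeomorph N (Coord n)) (u : Coord n) : Matrix (Fin n) (Fin n) ℝ :=
  Matrix.of fun i j =>
    g.inner (e.symm u)
      (mfderiv (𝓡 n) (𝓡 n) e.symm u (EuclideanSpace.single i (1 : ℝ) : Coord n))
      (mfderiv (𝓡 n) (𝓡 n) e.symm u (EuclideanSpace.single j (1 : ℝ) : Coord n))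

/-- The sectional curvature of `g` at `p` of the plane spanned by the tangent vectors `v`, `w`,
computed in the preferred chart at `p`. -/
def sectionalCurvature [IsManifold (𝓡 n) ∞ N] (g : RiemMetric n N) (p : N)
    (v w : TangentSpace (𝓡 n) p) : ℝ :=
  coordSectionalCurvature (metricCoeff g (chartAt (Coord n) p)) (chartAt (Coord n) p p)
    (mfderiv (𝓡 n) (𝓡 n) (chartAt (Coord n) p) p v)
    (mfderiv (𝓡 n) (𝓡 n) (chartAt (Coord n) p) p w)

/-- All sectional curvatures of `g` are positive. -/
def PositivelyCurved [IsManifold (𝓡 n) ∞ N] (g : RiemMetric n N) : Prop :=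
  ∀ (p : N) (v w : TangentSpace (𝓡 n) p), LinearIndependent ℝ ![v, w] →
    0 < sectionalCurvature g p v w

/-- Every element of the group `G` acts as a Riemannian isometry of `(N, g)`: its action is smooth
and its differential preserves the metric. -/
def ActsByIsometries [IsManifold (𝓡 n) ∞ N] (g : RiemMetric n N) (G : Type*) [Group G]
    [MulAction G N] : Prop :=
  ∀ t : G, ContMDiff (𝓡 n) (𝓡 n) ∞ (fun p : N => t • p) ∧
    ∀ (p : N) (v w : TangentSpace (𝓡 n) p),
      g.inner (t • p) (mfderiv (𝓡 n) (𝓡 n) (fun q : N => t • q) p v)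
        (mfderiv (𝓡 n) (𝓡 n) (fun q : N => t • q) p w) = g.inner p v w

/-- Near its point `y`, the set `S` is an embedded submanifold of codimension `k`: some smooth
chart of `N` around `y` carries `S` to a linear subspace of `ℝⁿ` of codimension `k`. -/
def HasCodimAt (S : Set N) (y : N) (k : ℕ) : Prop :=
  ∃ e ∈ IsManifold.maximalAtlas (𝓡 n) ∞ N, y ∈ e.source ∧
    ∃ W : Submodule ℝ (Coord n), Module.finrank ℝ W + k = n ∧
      ∀ z ∈ e.source, z ∈ S ↔ e z ∈ W

/-- The set `S` is an embedded submanifold of `N` of codimension `k`. -/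
def HasCodim (S : Set N) (k : ℕ) : Prop :=
  ∀ y ∈ S, HasCodimAt (n := n) S y k

end Manifold

/-- `N^σ_x`: the connected component containing `x` of the fixed-point set of `σ`. -/
def fixedComponent {G N : Type*} [Group G] [MulAction G N] [TopologicalSpace N]
    (σ : G) (x : N) : Set N :=
  connectedComponentIn {y : N | σ • y = y} x

/-- `δ(n)` is `0` if `n` is even and `1` if `n` is odd. -/
def parity (n : ℕ) : ℝ := if Even n then 0 else 1

/-- `σ` is an involution whose fixed component `N^σ_x` is an embedded submanifold of codimension
`k`, where `k` is divisible by four and `0 < k ≤ (n - c) / 2`. -/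
def IsSmallInvolution {n : ℕ} {N : Type*} [TopologicalSpace N] [ChartedSpace (Coord n) N]
    {G : Type*} [Group G] [MulAction G N] (c : ℕ) (x : N) (σ : G) (k : ℕ) : Prop :=
  orderOf σ = 2 ∧ HasCodim (n := n) (fixedComponent σ x) k ∧
    4 ∣ k ∧ 0 < k ∧ (k : ℝ) ≤ ((n : ℝ) - (c : ℝ)) / 2

end TorusFixedPoints

end

open scoped Manifold ContDiff

noncomputable section

namespace TorusFixedPoints

/-! ### Real representations of elementary abelian 2-groups -/

section Representations

variable {V : Type*} [AddCommGroup V] [Module ℝ V]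

/-! The problem reduces to binary codes. The torus acts linearly on the tangent space at `x`
(`isotropyRep`), and its involutions, together with 1, form `{±1}^s`, which acts diagonally through
sign characters. A square root of an involution in the torus gives a complex structure where that
involution acts as `-1`, so each nontrivial character has even multiplicity. Keeping one of each
pair leaves `e_1, …, e_k` with `2k ≤ n` and gives every sign vector `b` a word `(e_j b)_j`
(`exists_code`). By Bochner linearization (`hasCodimAt_fixedPoints`) the common fixed set of several
involutions has codimension at `x` twice the size of the union of their supports. Effectiveness
makes nontrivial words nonzero (`wordSupport_nonempty`).

Small involutions thus come from nonzero words of even weight `w` with `4w < D = n - c + 1`. Parity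
of the overlap with a fixed set of coordinates is a character, so each parity condition, like each
prescribed zero, at most halves the group. `exists_light_word` averages the weight over the subgroup
cut out by `q` parity conditions and `t` prescribed zeros. The average is at most `(k - t)/2`; with
`t = ⌊(c + 2 - δ)/2⌋` it is below `D/4` by a margin that, for `s` as large as assumed, survives
discarding the zero word.

Part 1 takes `q = 1`, even total weight. Part 2 takes `q = 2`, adding even overlap with the word `a`
of `σ`, so that the union of supports has even size. One prescribed zero lies in the support of `a`;
an inclusion `N^τ_x ⊆ N^σ_x` would force the support of `a` into that of `b`, contradicting this
zero. -/

theorem even_finrank_of_sq_eq_neg (J : V →ₗ[ℝ] V) (hJ : ∀ v, J (J v) = -v) :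
    Even (Module.finrank ℝ V) := by
  by_contra h
  have h1 : J * J = (-1 : ℝ) • (LinearMap.id : V →ₗ[ℝ] V) := by
    ext v
    simp [hJ]
  -- A real square is nonnegative, so `(-1) ^ dim` cannot be `-1`.
  have h2 : LinearMap.det J * LinearMap.det J = (-1 : ℝ) ^ Module.finrank ℝ V := by
    rw [← map_mul, h1, LinearMap.det_smul]
    simp
  rw [(Nat.not_even_iff_odd.1 h).neg_one_pow] at h2
  nlinarith [mul_self_nonneg (LinearMap.det J)]

theorem iSup_maxGenEigenspace_eq_top_of_sq_eq_one (f : Module.End ℝ V) (hf : f * f = 1) :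
    ⨆ μ, f.maxGenEigenspace μ = ⊤ := by
  have hf' : ∀ v, f (f v) = v := fun v => congrArg (fun g : Module.End ℝ V => g v) hf
  rw [eq_top_iff]
  intro v _
  have h1 : (1 / 2 : ℝ) • (v + f v) ∈ ⨆ μ, f.maxGenEigenspace μ := by
    refine Submodule.mem_iSup_of_mem 1 (Module.End.mem_maxGenEigenspace _ _ _ |>.2 ⟨1, ?_⟩)
    simp [hf', add_comm]
  have h2 : (1 / 2 : ℝ) • (v - f v) ∈ ⨆ μ, f.maxGenEigenspace μ := by
    refine Submodule.mem_iSup_of_mem (-1) (Module.End.mem_maxGenEigenspace _ _ _ |>.2 ⟨1, ?_⟩)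
    simp [hf']
  have := add_mem h1 h2
  rwa [← smul_add, show v + f v + (v - f v) = (2 : ℝ) • v by rw [two_smul]; abel, smul_smul,
    show (1 / 2 : ℝ) * 2 = 1 by norm_num, one_smul] at this

theorem apply_eq_smul_of_mem_maxGenEigenspace (f : Module.End ℝ V) (hf : f * f = 1) {μ : ℝ}
    {v : V} (hv : v ∈ f.maxGenEigenspace μ) : f v = μ • v := by
  have hs : f.IsSemisimple := by
    have hsq : Squarefree (Polynomial.X ^ 2 - 1 : Polynomial ℝ) :=
      ((Polynomial.separable_X_pow_sub_C (1 : ℝ) (n := 2) (by norm_num) one_ne_zero)).squarefree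
    refine Module.End.isSemisimple_of_squarefree_aeval_eq_zero hsq ?_
    simp [pow_two, hf]
  rw [hs.isFinitelySemisimple.maxGenEigenspace_eq_eigenspace] at hv
  exact Module.End.mem_eigenspace_iff.1 hv

variable {B : Type*} [CommGroup B]

/-- A sign valued function with which a nonzero vector transforms is a homomorphism. -/
theorem exists_signHom (ρ : B →* Module.End ℝ V) (hB : ∀ b : B, b * b = 1) {v : V} (hv : v ≠ 0)
    {χ : B → ℝ} (h : ∀ b, ρ b v = χ b • v) :
    ∃ ε : B →* ℤˣ, ∀ b, ρ b v = ((ε b : ℤ) : ℝ) • v := by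
  have hinj : ∀ {r t : ℝ}, r • v = t • v → r = t := fun hrt => smul_left_injective ℝ hv hrt
  have hmul : ∀ a b, χ (a * b) = χ a * χ b := fun a b => by
    apply hinj
    rw [← h, map_mul, Module.End.mul_apply, h b, map_smul, h a, smul_smul, mul_comm]
  have hone : χ 1 = 1 := by
    apply hinj
    rw [← h, map_one, one_smul]; rfl
  have hsq : ∀ b, χ b = 1 ∨ χ b = -1 := fun b => by
    rw [← mul_self_eq_one_iff, ← hmul, hB, hone]
  classical
  refine ⟨MonoidHom.mk' (fun b => if χ b = 1 then 1 else -1) ?_, fun b => ?_⟩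
  · intro a b
    rcases hsq a with ha | ha <;> rcases hsq b with hb | hb <;> (simp [hmul, ha, hb]; try norm_num)
  · rcases hsq b with hb | hb <;> rw [h b] <;> (simp [hb]; try norm_num)

/-- Commuting involutions are simultaneously diagonalizable over `ℝ`, and the eigenvalues on a fixed
joint eigenvector are multiplicative in the group element. -/
theorem exists_joint_eigenbasis [FiniteDimensional ℝ V] (ρ : B →* Module.End ℝ V)
    (hB : ∀ b : B, b * b = 1) :
    ∃ (b : Module.Basis (Fin (Module.finrank ℝ V)) ℝ V)
      (ε : Fin (Module.finrank ℝ V) → B →* ℤˣ),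
      ∀ i a, ρ a (b i) = ((ε i a : ℤ) : ℝ) • b i := by
  have hsq : ∀ a, ρ a * ρ a = 1 := fun a => by rw [← map_mul, hB, map_one]
  have htop := Module.End.iSup_iInf_maxGenEigenspace_eq_top_of_iSup_maxGenEigenspace_eq_top_of_commute
    (fun a => ρ a) (fun a a' _ => by
      change ρ a * ρ a' = ρ a' * ρ a
      rw [← map_mul, ← map_mul, mul_comm])
    (fun a => iSup_maxGenEigenspace_eq_top_of_sq_eq_one _ (hsq a))
  let S : Set V := {v | ∃ χ : B → ℝ, ∀ a, ρ a v = χ a • v}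
  have hS : ⊤ ≤ Submodule.span ℝ S := by
    rw [← htop]
    refine iSup_le fun χ v hv => Submodule.subset_span ⟨χ, fun a => ?_⟩
    exact apply_eq_smul_of_mem_maxGenEigenspace _ (hsq a) ((Submodule.mem_iInf _).1 hv a)
  let b₀ := Module.Basis.ofSpan hS
  let b := b₀.reindex (b₀.indexEquiv (Module.finBasis ℝ V))
  have hb : ∀ i, b i ∈ S := fun i => by
    rw [Module.Basis.reindex_apply]
    exact Module.Basis.ofSpan_subset hS (Set.mem_range_self _)
  choose χ hχ using hb
  choose ε hε using fun i => exists_signHom ρ hB (b.ne_zero i) (hχ i)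
  exact ⟨b, ε, hε⟩

/-- The vectors on which the elements of `Q` act through the signs `χ`. -/
def weightSpace (ρ : B →* Module.End ℝ V) (Q : Set B) (χ : B → ℤˣ) : Submodule ℝ V where
  carrier := {v | ∀ a ∈ Q, ρ a v = ((χ a : ℤ) : ℝ) • v}
  add_mem' hv hw a ha := by rw [map_add, hv a ha, hw a ha, smul_add]
  zero_mem' a _ := by simp
  smul_mem' r v hv a ha := by rw [map_smul, hv a ha, smul_comm]

-- In an eigenbasis membership is a condition on each coordinate separately. `Q = univ` yields the
-- multiplicity of a character, `χ = 1` the fixed space of `Q`.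
open Classical in
theorem finrank_weightSpace (ρ : B →* Module.End ℝ V) {ι : Type*} [Fintype ι]
    (b : Module.Basis ι ℝ V) (ε : ι → B →* ℤˣ)
    (hb : ∀ i a, ρ a (b i) = ((ε i a : ℤ) : ℝ) • b i) (Q : Set B) (χ : B → ℤˣ) :
    Module.finrank ℝ (weightSpace ρ Q χ) =
      (Finset.univ.filter fun i => ∀ a ∈ Q, ε i a = χ a).card := by
  set s : Set ι := {i | ∀ a ∈ Q, ε i a = χ a} with hs
  have hspan : weightSpace ρ Q χ = Submodule.span ℝ (Set.range fun i : s => b i) := by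
    rw [show (Set.range fun i : s => b i) = b '' s by ext; simp]
    ext v
    rw [Module.Basis.mem_span_image]
    have hrepr : ∀ a i, b.repr (ρ a v) i = ((ε i a : ℤ) : ℝ) * b.repr v i := fun a i => by
      conv_lhs => rw [← b.sum_repr v]
      simp only [map_sum, map_smul, hb, Finsupp.coe_finsetSum, Finset.sum_apply,
        Finsupp.smul_apply, b.repr_self, smul_eq_mul]
      rw [Finset.sum_eq_single i]
      · simp; ring
      · intro j _ hj
        simp [hj]
      · simp
    constructor
    · intro hv i hi a ha
      have h1 := hrepr a i
      rw [hv a ha] at h1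
      simp only [map_smul, Finsupp.smul_apply, smul_eq_mul] at h1
      have h2 := mul_right_cancel₀ (Finsupp.mem_support_iff.1 hi) h1
      exact Units.ext (by exact_mod_cast h2.symm)
    · intro hv a ha
      apply b.repr.injective
      ext i
      rw [hrepr a i]
      simp only [map_smul, Finsupp.smul_apply, smul_eq_mul]
      by_cases hi : b.repr v i = 0
      · simp [hi]
      · rw [hv (Finsupp.mem_support_iff.2 hi) a ha]
  rw [hspan, finrank_span_eq_card (b := fun i : s => b i)
    (b.linearIndependent.comp _ Subtype.val_injective), Fintype.card_subtype]
  rfl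

/-- If an involution acts as `-1` on a joint weight space and has a square root in a commuting
extension of the representation, the weight space is even-dimensional. -/
theorem even_finrank_weightSpace (ρ : B →* Module.End ℝ V) (χ : B → ℤˣ) {a : B} (ha : χ a = -1)
    (r : Module.End ℝ V) (hr : r * r = ρ a) (hcomm : ∀ b, r * ρ b = ρ b * r) :
    Even (Module.finrank ℝ (weightSpace ρ Set.univ χ)) := by
  have hmaps : ∀ v ∈ weightSpace ρ Set.univ χ, r v ∈ weightSpace ρ Set.univ χ := by
    intro v hv b hb
    rw [← Module.End.mul_apply, ← hcomm, Module.End.mul_apply, hv b hb, map_smul]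
  refine even_finrank_of_sq_eq_neg (r.restrict hmaps) fun v => Subtype.ext ?_
  change (r * r) v = -(v : V)
  rw [hr, v.2 a trivial, ha]
  simp

end Representations

/-! ### Halving multiplicities; involutions of the torus and their code -/

/-- A finite family in which every value other than `x₀` is taken an even number of times is, away
from `x₀`, the double of another family. -/
theorem exists_half_family {ι X : Type*} [Fintype ι] [DecidableEq X] (f : ι → X) (x₀ : X)
    (h : ∀ x, x ≠ x₀ → Even (Finset.univ.filter fun i => f i = x).card) :
    ∃ (k : ℕ) (f' : Fin k → X), (∀ j, f' j ≠ x₀) ∧ ∀ (p : X → Prop) [DecidablePred p], ¬ p x₀ →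
      (Finset.univ.filter fun i => p (f i)).card
        = 2 * (Finset.univ.filter fun j => p (f' j)).card := by
  let M : Multiset X := (Finset.univ.val.map f).filter (· ≠ x₀)
  have hcount : ∀ x, Even (M.count x) := by
    intro x
    by_cases hx : x = x₀
    · subst hx
      rw [Multiset.count_eq_zero_of_notMem (by simp [M])]
      exact Even.zero
    · rw [Multiset.count_filter_of_pos (by simpa using hx), Multiset.count_map]
      convert h x hx using 1
      simp only [Finset.card, Finset.filter_val]
      congr 2
      ext i
      exact eq_comm
  obtain ⟨M', hM'⟩ : ∃ M' : Multiset X, M = M' + M' := by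
    -- By `hcount` the truncating division by 2 is exact.
    refine ⟨Finsupp.toMultiset ((Multiset.toFinsupp M).mapRange (fun k => k / 2) (by simp)), ?_⟩
    ext x
    rw [Multiset.count_add, Finsupp.count_toMultiset]
    obtain ⟨k, hk⟩ := hcount x
    simp only [Finsupp.mapRange_apply, Multiset.toFinsupp_apply]
    omega
  refine ⟨M'.toList.length, fun j => M'.toList.get j, fun j => ?_, fun p _ hp => ?_⟩
  · have hj : M'.toList.get j ∈ M := by
      rw [hM', Multiset.mem_add, ← Multiset.mem_toList]
      exact Or.inl (List.get_mem _ _)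
    exact (Multiset.mem_filter.1 hj).2
  have h1 : (Finset.univ.filter fun i => p (f i)).card = M.countP p := by
    rw [Multiset.countP_filter, Multiset.countP_map]
    simp only [Finset.card, Finset.filter_val]
    congr 2
    ext i
    exact ⟨fun hi => ⟨hi, fun h0 => hp (h0 ▸ hi)⟩, fun hi => hi.1⟩
  have h2 : (Finset.univ.filter fun j => p (M'.toList.get j)).card = M'.countP p := by
    conv_rhs => rw [← Multiset.coe_toList M', ← List.ofFn_get M'.toList]
    rw [Multiset.coe_countP, List.ofFn_eq_map, List.countP_map, List.countP_eq_length_filter]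
    rfl
  rw [h1, h2, hM', Multiset.countP_add]
  ring

/-- The sign `±1`, as a point of the circle. -/
def signToCircle : ℤˣ →* Circle where
  toFun u := ⟨((u : ℤ) : ℂ), mem_sphere_zero_iff_norm.2 (by
    rcases Int.units_eq_one_or u with rfl | rfl <;> simp)⟩
  map_one' := by ext; simp
  map_mul' u v := by
    ext
    change (((u * v : ℤˣ) : ℤ) : ℂ) = ((u : ℤ) : ℂ) * ((v : ℤ) : ℂ)
    push_cast
    rfl

@[simp]
theorem coe_signToCircle (u : ℤˣ) : (signToCircle u : ℂ) = ((u : ℤ) : ℂ) := rfl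

/-- The involutions of the torus, as sign vectors. -/
def involution (s : ℕ) : (Fin s → ℤˣ) →* Torus s where
  toFun a i := signToCircle (a i)
  map_one' := by ext; simp
  map_mul' a b := by ext; simp

theorem involution_injective (s : ℕ) : Function.Injective (involution s) := by
  intro a b h
  funext i
  have h1 := congrArg (fun t : Torus s => (t i : ℂ)) h
  change (((a i : ℤ) : ℂ)) = ((b i : ℤ) : ℂ) at h1
  exact Units.ext (by exact_mod_cast h1)

theorem signs_mul_self {s : ℕ} (a : Fin s → ℤˣ) : a * a = 1 := by
  funext i
  exact Int.units_mul_self (a i)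

theorem orderOf_involution {s : ℕ} {a : Fin s → ℤˣ} (ha : a ≠ 1) :
    orderOf (involution s a) = 2 := by
  refine orderOf_eq_prime ?_ fun h => ha (involution_injective s (h.trans (map_one _).symm))
  rw [pow_two, ← map_mul, signs_mul_self, map_one]

theorem exists_involution_eq {s : ℕ} {t : Torus s} (ht : orderOf t = 2) :
    ∃ a : Fin s → ℤˣ, a ≠ 1 ∧ involution s a = t := by
  have h1 : ∀ i, ∃ u : ℤˣ, signToCircle u = t i := by
    intro i
    have h2 : (t i : ℂ) * (t i : ℂ) = 1 := by
      have h3 := congrArg (fun t : Torus s => (t i : ℂ)) (ht ▸ pow_orderOf_eq_one t)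
      simpa [pow_two] using h3
    rcases mul_self_eq_one_iff.1 h2 with h | h
    · exact ⟨1, by ext; simp [h]⟩
    · exact ⟨-1, by ext; simp [h]⟩
  choose a ha using h1
  have hat : involution s a = t := funext ha
  refine ⟨a, fun h => ?_, hat⟩
  rw [← hat, h, map_one, orderOf_one] at ht
  omega

/-- Divisibility of the torus is what pairs up the nontrivial sign characters and makes the
codimensions even. -/
theorem exists_mul_self_eq {s : ℕ} (t : Torus s) : ∃ r : Torus s, r * r = t := by
  refine ⟨fun i => Circle.exp (Complex.arg (t i) / 2), funext fun i => ?_⟩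
  rw [Pi.mul_apply, ← Circle.exp_add, add_halves, Circle.exp_arg]

/-- The code of a torus representation: the fixed spaces of sets of involutions have codimension
twice the size of the union of the supports of the corresponding words. -/
theorem exists_code {s : ℕ} {V : Type*} [AddCommGroup V] [Module ℝ V] [FiniteDimensional ℝ V]
    (ρ : Torus s →* Module.End ℝ V) :
    ∃ (k : ℕ) (e : Fin k → (Fin s → ℤˣ) →* ℤˣ), 2 * k ≤ Module.finrank ℝ V ∧
      ∀ Q : Finset (Fin s → ℤˣ),
        Module.finrank ℝ (weightSpace (ρ.comp (involution s)) Q 1)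
          + 2 * (Finset.univ.filter fun j => ∃ a ∈ Q, e j a = -1).card
            = Module.finrank ℝ V := by
  classical
  set ρ' := ρ.comp (involution s)
  obtain ⟨b, ε, hb⟩ := exists_joint_eigenbasis ρ' signs_mul_self
  have heven : ∀ χ : (Fin s → ℤˣ) →* ℤˣ, χ ≠ 1 →
      Even (Finset.univ.filter fun i => ε i = χ).card := by
    intro χ hχ
    obtain ⟨a, ha⟩ : ∃ a, χ a = -1 := by
      by_contra! h
      exact hχ (MonoidHom.ext fun a => (Int.units_eq_one_or (χ a)).resolve_right (h a))
    obtain ⟨r, hr⟩ := exists_mul_self_eq (involution s a)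
    have h1 := even_finrank_weightSpace ρ' χ ha (ρ r) (by rw [← map_mul, hr]; rfl)
      (fun c => by
        change ρ r * ρ (involution s c) = ρ (involution s c) * ρ r
        rw [← map_mul, ← map_mul, mul_comm])
    rw [finrank_weightSpace ρ' b ε hb] at h1
    convert h1 using 4 with i
    exact ⟨fun h a _ => by rw [h], fun h => MonoidHom.ext fun a => h a trivial⟩
  obtain ⟨k, e, he, hcount⟩ := exists_half_family ε 1 heven
  refine ⟨k, e, ?_, fun Q => ?_⟩
  · have h1 := hcount (· ≠ 1) (by simp)
    rw [Finset.filter_true_of_mem (s := (Finset.univ : Finset (Fin k))) (fun j _ => he j),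
      Finset.card_univ, Fintype.card_fin] at h1
    rw [← h1]
    exact (Finset.card_le_univ _).trans (by simp)
  · have h1 := hcount (fun χ => ∃ a ∈ Q, χ a = -1) (by simp)
    rw [finrank_weightSpace ρ' b ε hb, ← h1]
    have h2 := Finset.card_filter_add_card_filter_not
      (s := (Finset.univ : Finset (Fin (Module.finrank ℝ V))))
      (fun i => ∀ a ∈ (Q : Set (Fin s → ℤˣ)), ε i a = (1 : (Fin s → ℤˣ) → ℤˣ) a)
    rw [Finset.card_univ, Fintype.card_fin] at h2
    refine Eq.trans ?_ h2
    congr 3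
    ext i
    have : ∀ a, ε i a = -1 ↔ ¬ ε i a = 1 := fun a => by
      rcases Int.units_eq_one_or (ε i a) with h | h <;> rw [h] <;> decide
    simp [this]

/-! ### Binary codes and the averaging argument -/

section Codes

variable {k : ℕ} {B : Type*} [CommGroup B]

/-- The support of the word of `b`. -/
def wordSupport (e : Fin k → B →* ℤˣ) (b : B) : Finset (Fin k) :=
  Finset.univ.filter fun j => e j b = -1

theorem mem_wordSupport {e : Fin k → B →* ℤˣ} {b : B} {j : Fin k} :
    j ∈ wordSupport e b ↔ e j b = -1 := by simp [wordSupport]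

/-- Parity of the overlap with `S` is thereby a homomorphism, so it can be imposed by passing to a
kernel. -/
theorem prod_sign_eq (e : Fin k → B →* ℤˣ) (S : Finset (Fin k)) (b : B) :
    ∏ j ∈ S, e j b = (-1) ^ (S ∩ wordSupport e b).card := by
  rw [← Finset.prod_const, ← Finset.filter_mem_eq_inter, Finset.prod_filter]
  refine Finset.prod_congr rfl fun j _ => ?_
  rcases Int.units_eq_one_or (e j b) with h | h <;> simp [mem_wordSupport, h]

theorem even_card_of_prod_sign_eq_one {e : Fin k → B →* ℤˣ} {S : Finset (Fin k)} {b : B}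
    (h : ∏ j ∈ S, e j b = 1) : Even (S ∩ wordSupport e b).card := by
  rw [prod_sign_eq] at h
  by_contra hodd
  rw [(Nat.not_even_iff_odd.1 hodd).neg_one_pow] at h
  exact absurd h (by decide)

/-- At most half of the elements of a subgroup have a given sign equal to `-1`. -/
theorem two_mul_card_neg_le [Fintype B] [DecidableEq B] (H : Subgroup B) [DecidablePred (· ∈ H)]
    (χ : B →* ℤˣ) :
    2 * (Finset.univ.filter fun b => b ∈ H ∧ χ b = -1).card
      ≤ (Finset.univ.filter fun b => b ∈ H).card := by
  by_cases h : ∃ a ∈ H, χ a = -1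
  · obtain ⟨a, haH, ha⟩ := h
    have h1 : (Finset.univ.filter fun b => b ∈ H ∧ χ b = -1).card
        -- Translation by `a` carries the elements of sign `-1` into those of sign `1`.
        ≤ (Finset.univ.filter fun b => b ∈ H ∧ ¬ χ b = -1).card := by
      refine Finset.card_le_card_of_injOn (fun b => a * b) ?_ (fun _ _ _ _ h => mul_left_cancel h)
      intro b hb
      simp only [Finset.coe_filter, Finset.mem_univ, true_and, Set.mem_ofPred_eq] at hb ⊢
      refine ⟨H.mul_mem haH hb.1, ?_⟩
      rw [map_mul, ha, hb.2]
      decide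
    have h2 := Finset.card_filter_add_card_filter_not (s := Finset.univ.filter fun b => b ∈ H)
      (fun b => χ b = -1)
    rw [Finset.filter_filter, Finset.filter_filter] at h2
    omega
  · push Not at h
    rw [Finset.filter_false_of_mem (fun b _ hb => h b hb.1 hb.2)]
    simp

/-- Averaging over a subcode: a large code contains a light nontrivial word which satisfies `q`
parity conditions and vanishes on a given set `T` of coordinates. -/
theorem exists_light_word [Fintype B] (e : Fin k → B →* ℤˣ) {q : ℕ} (ψ : Fin q → B →* ℤˣ)
    (T : Finset (Fin k)) {D : ℕ} (hD : 2 * k < D + 2 * T.card)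
    (hcard : D * 2 ^ (q + T.card) < (D + 2 * T.card - 2 * k) * Fintype.card B) :
    ∃ b : B, b ≠ 1 ∧ (∀ i, ψ i b = 1) ∧ (∀ j ∈ T, e j b = 1) ∧
      4 * (wordSupport e b).card < D := by
  classical
  by_contra! hcon
  let Ψ : B →* ((Fin q → ℤˣ) × (T → ℤˣ)) :=
    (MonoidHom.pi ψ).prod (MonoidHom.pi fun j : T => e j)
  let H := Ψ.ker
  have hmem : ∀ b, b ∈ H ↔ (∀ i, ψ i b = 1) ∧ ∀ j ∈ T, e j b = 1 := by
    intro b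
    rw [MonoidHom.mem_ker, Prod.ext_iff]
    constructor
    · rintro ⟨h1, h2⟩
      exact ⟨fun i => congrFun h1 i, fun j hj => congrFun h2 ⟨j, hj⟩⟩
    · rintro ⟨h1, h2⟩
      exact ⟨funext h1, funext fun j => h2 j j.2⟩
  set HF : Finset B := Finset.univ.filter fun b => b ∈ H with hHF
  have hHcard : Fintype.card B ≤ HF.card * 2 ^ (q + T.card) := by
    have h1 := H.card_mul_index
    have h2 : H.index ≤ 2 ^ (q + T.card) := by
      rw [Subgroup.index_ker]
      refine (Nat.card_le_card_of_injective (Subtype.val : Ψ.range → _)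
        Subtype.val_injective).trans (le_of_eq ?_)
      simp [Nat.card_eq_fintype_card, pow_add]
    have h3 : Nat.card H = HF.card := by
      rw [Nat.card_eq_fintype_card, Fintype.card_subtype]
    rw [← Nat.card_eq_fintype_card, ← h1, h3]
    exact Nat.mul_le_mul_left _ h2
  have hone : (1 : B) ∈ HF := by simp [hHF, H.one_mem]
  -- Every element of `H` except 1 is assumed to have weight at least `D / 4`.
  have hlow : (HF.card - 1) * D ≤ 4 * ∑ b ∈ HF, (wordSupport e b).card := by
    rw [← Finset.card_erase_of_mem hone, Finset.mul_sum, ← smul_eq_mul]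
    refine (Finset.card_nsmul_le_sum _ _ _ fun b hb => ?_).trans
      (Finset.sum_le_sum_of_subset (Finset.erase_subset _ _))
    obtain ⟨h1, h2⟩ := Finset.mem_erase.1 hb
    obtain ⟨h3, h4⟩ := (hmem b).1 (Finset.mem_filter.1 h2).2
    exact hcon b h1 h3 h4
  -- Double counting: each coordinate outside `T` is `-1` on at most half of `H`, and those in `T`
  -- never are.
  have hupp : 2 * ∑ b ∈ HF, (wordSupport e b).card ≤ (k - T.card) * HF.card := by
    have h1 : ∑ b ∈ HF, (wordSupport e b).card
        = ∑ j ∈ Tᶜ, (Finset.univ.filter fun b => b ∈ H ∧ e j b = -1).card := by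
      have h2 : ∀ b ∈ HF, (wordSupport e b).card
          = ∑ j ∈ Tᶜ, if e j b = -1 then 1 else 0 := by
        intro b hb
        rw [← Finset.card_filter]
        congr 1
        ext j
        simp only [mem_wordSupport, Finset.mem_filter, Finset.mem_compl]
        refine ⟨fun h => ⟨fun hj => ?_, h⟩, fun h => h.2⟩
        rw [((hmem b).1 (Finset.mem_filter.1 hb).2).2 j hj] at h
        exact absurd h (by decide)
      rw [Finset.sum_congr rfl h2, Finset.sum_comm]
      refine Finset.sum_congr rfl fun j _ => ?_
      rw [← Finset.card_filter, hHF, Finset.filter_filter]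
    rw [h1, Finset.mul_sum]
    refine (Finset.sum_le_card_nsmul _ _ _ fun j _ => two_mul_card_neg_le H (e j)).trans ?_
    rw [Finset.card_compl, Fintype.card_fin, smul_eq_mul]
  have hT : T.card ≤ k := by simpa using Finset.card_le_univ T
  have hpos : 1 ≤ HF.card := Finset.card_pos.2 ⟨1, hone⟩
  have hfin : (D + 2 * T.card - 2 * k) * HF.card ≤ D := by
    zify [hpos, hT, hD.le] at hlow hupp ⊢
    nlinarith
  have h3 := Nat.mul_le_mul_left (D + 2 * T.card - 2 * k) hHcard
  rw [← mul_assoc] at h3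
  have h4 := Nat.mul_le_mul_right (2 ^ (q + T.card)) hfin
  omega

end Codes

/-! ### Codimension of locally linear subsets -/

section Codimension

open Filter Topology

variable {n : ℕ} {N : Type*} [TopologicalSpace N] [ChartedSpace (Coord n) N]

/-- The codimension at `y` depends only on the germ of the set at `y`. -/
theorem HasCodimAt.congr {S S' : Set N} {y : N} {k : ℕ} (h : HasCodimAt (n := n) S y k)
    (hS : ∀ᶠ z in 𝓝 y, z ∈ S ↔ z ∈ S') : HasCodimAt (n := n) S' y k := by
  obtain ⟨e, he, hy, W, hW, heW⟩ := h
  obtain ⟨O, hO, hOo, hyO⟩ := eventually_nhds_iff.1 hS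
  refine ⟨e.restr O, restr_mem_maximalAtlas _ he hOo, ?_, W, hW, fun z hz => ?_⟩
  · rw [e.restr_source' O hOo]
    exact ⟨hy, hyO⟩
  · rw [e.restr_source' O hOo] at hz
    rw [← hO z hz.2]
    exact heW z hz.1

theorem HasCodimAt.eventually {S : Set N} {y : N} {k : ℕ} (h : HasCodimAt (n := n) S y k) :
    ∀ᶠ z in 𝓝 y, HasCodimAt (n := n) S z k := by
  obtain ⟨e, he, hy, W, hW, heW⟩ := h
  exact eventually_nhds_iff.2 ⟨e.source, fun z hz => ⟨e, he, hz, W, hW, heW⟩, e.open_source, hy⟩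

/-- The differential of the transition map is injective and carries `W` into `W'`, since the
transition map carries points of `W` near `e y` into `W'`. -/
theorem finrank_le_of_charts {S : Set N} {y : N} (hyS : y ∈ S)
    {e e' : OpenPartialHomeomorph N (Coord n)}
    (he : e ∈ IsManifold.maximalAtlas (𝓡 n) ∞ N) (he' : e' ∈ IsManifold.maximalAtlas (𝓡 n) ∞ N)
    (hy : y ∈ e.source) (hy' : y ∈ e'.source) {W W' : Submodule ℝ (Coord n)}
    (hW : ∀ z ∈ e.source, z ∈ S ↔ e z ∈ W) (hW' : ∀ z ∈ e'.source, z ∈ S ↔ e' z ∈ W')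
    [IsManifold (𝓡 n) ∞ N] :
    Module.finrank ℝ W ≤ Module.finrank ℝ W' := by
  have key : ∀ {a b : OpenPartialHomeomorph N (Coord n)},
      a ∈ IsManifold.maximalAtlas (𝓡 n) ∞ N → b ∈ IsManifold.maximalAtlas (𝓡 n) ∞ N →
      y ∈ a.source → y ∈ b.source → DifferentiableAt ℝ (b ∘ a.symm) (a y) := by
    intro a b ha hb hya hyb
    have h1 : ContMDiffAt (𝓡 n) (𝓡 n) ∞ (b ∘ a.symm) (a y) := by
      refine ContMDiffAt.comp (a y) ?_ (contMDiffAt_symm_of_mem_maximalAtlas ha (a.map_source hya))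
      rw [a.left_inv hya]
      exact contMDiffAt_of_mem_maximalAtlas hb hyb
    exact (contMDiffAt_iff_contDiffAt.1 h1).differentiableAt (by simp)
  set f := e' ∘ e.symm with hf
  have hfu : f (e y) = e' y := by simp [hf, e.left_inv hy]
  have hfd := (key he he' hy hy').hasFDerivAt
  have hgd := (key he' he hy' hy).hasFDerivAt
  rw [← hfu] at hgd
  have hcont : ContinuousAt e.symm (e y) := e.continuousAt_symm (e.map_source hy)
  have hcomp := hgd.comp (e y) hfd
  have hsource : ∀ᶠ v in 𝓝 (e y), e.symm v ∈ e'.source :=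
    hcont (by rw [e.left_inv hy]; exact e'.open_source.mem_nhds hy')
  have htarget : ∀ᶠ v in 𝓝 (e y), v ∈ e.target := e.open_target.mem_nhds (e.map_source hy)
  have hid : (e ∘ e'.symm) ∘ (e' ∘ e.symm) =ᶠ[𝓝 (e y)] id := by
    filter_upwards [hsource, htarget] with v h1 h2
    simp [e'.left_inv h1, e.right_inv h2]
  have hinv := hcomp.unique ((hasFDerivAt_id (𝕜 := ℝ) (e y)).congr_of_eventuallyEq hid)
  have hinj : Function.Injective (fderiv ℝ f (e y)) := fun v w hvw => by
    have h1 := congrArg (fun L : Coord n →L[ℝ] Coord n => L v) hinv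
    have h2 := congrArg (fun L : Coord n →L[ℝ] Coord n => L w) hinv
    simp only [ContinuousLinearMap.comp_apply, ContinuousLinearMap.id_apply] at h1 h2
    rw [← h1, ← h2, hvw]
  have hmaps : ∀ w ∈ W, fderiv ℝ f (e y) w ∈ W' := by
    intro w hw
    have hline : HasDerivAt (fun t : ℝ => e y + t • w) w 0 := by
      simpa using ((hasDerivAt_id (0 : ℝ)).smul_const w).const_add (e y)
    have hfd0 : HasFDerivAt f (fderiv ℝ f (e y)) (e y + (0 : ℝ) • w) := by simpa using hfd
    have hder : HasDerivAt (f ∘ fun t : ℝ => e y + t • w) (fderiv ℝ f (e y) w) 0 :=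
      hfd0.comp_hasDerivAt 0 hline
    have hlim := hasDerivAt_iff_tendsto_slope.1 hder
    have htend : Tendsto (fun t : ℝ => e y + t • w) (𝓝 0) (𝓝 (e y)) := by
      simpa using hline.continuousAt.tendsto
    -- The derivative along `w` is a limit of difference quotients lying in the closed subspace
    -- `W'`.
    refine (W'.closed_of_finiteDimensional).mem_of_tendsto hlim
      (Filter.Eventually.filter_mono nhdsWithin_le_nhds ?_)
    have h0 : f (e y) ∈ W' := by
      rw [hfu]
      exact (hW' y hy').1 hyS
    filter_upwards [htend.eventually hsource, htend.eventually htarget] with t h1 h2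
    rw [slope_def_module]
    refine W'.smul_mem _ (W'.sub_mem ?_ (by simpa using h0))
    have h3 : e.symm (e y + t • w) ∈ S := by
      rw [hW _ (e.map_target h2), e.right_inv h2]
      exact W.add_mem ((hW y hy).1 hyS) (W.smul_mem _ hw)
    exact (hW' _ h1).1 h3
  exact LinearMap.finrank_le_finrank_of_injective
    (f := ((fderiv ℝ f (e y)).toLinearMap).restrict hmaps)
    fun v w hvw => Subtype.ext (hinj (congrArg Subtype.val hvw))

variable [IsManifold (𝓡 n) ∞ N]

theorem HasCodimAt.unique {S : Set N} {y : N} (hyS : y ∈ S) {k k' : ℕ}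
    (h : HasCodimAt (n := n) S y k) (h' : HasCodimAt (n := n) S y k') : k = k' := by
  obtain ⟨e, he, hy, W, hWk, hW⟩ := h
  obtain ⟨e', he', hy', W', hWk', hW'⟩ := h'
  have h1 := finrank_le_of_charts hyS he he' hy hy' hW hW'
  have h2 := finrank_le_of_charts hyS he' he hy' hy hW' hW
  omega

/-- The codimension is constant on connected subsets. -/
theorem HasCodimAt.of_isPreconnected {S C : Set N} (hS : ∀ y ∈ S, ∃ k, HasCodimAt (n := n) S y k)
    (hC : IsPreconnected C) (hCS : C ⊆ S) {x : N} (hx : x ∈ C) {k : ℕ}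
    (hk : HasCodimAt (n := n) S x k) {y : N} (hy : y ∈ C) : HasCodimAt (n := n) S y k := by
  let U (P : ℕ → Prop) : Set N := interior {z | ∃ j, P j ∧ HasCodimAt (n := n) S z j}
  have hU : ∀ {P : ℕ → Prop} {z : N} {j : ℕ}, P j → HasCodimAt (n := n) S z j → z ∈ U P :=
    fun hP hz => mem_interior_iff_mem_nhds.2 (by
      filter_upwards [hz.eventually] with w hw
      exact ⟨_, hP, hw⟩)
  -- The loci of codimension `k` and of codimension other than `k` are open, cover `C`, and are
  -- disjoint on it by uniqueness.
  have h1 := isPreconnected_iff_subset_of_disjoint.1 hC (U (· = k)) (U (· ≠ k)) isOpen_interior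
    isOpen_interior ?_ ?_
  · rcases h1 with h1 | h1
    · obtain ⟨j, rfl, hj⟩ := interior_subset (h1 hy)
      exact hj
    · obtain ⟨j, hjk, hj⟩ := interior_subset (h1 hx)
      exact absurd (hj.unique (hCS hx) hk) hjk
  · intro z hz
    obtain ⟨j, hj⟩ := hS z (hCS hz)
    by_cases hjk : j = k
    · exact Or.inl (hU hjk hj)
    · exact Or.inr (hU hjk hj)
  · rw [Set.eq_empty_iff_forall_notMem]
    rintro z ⟨hz, h2, h3⟩
    obtain ⟨j, rfl, hj⟩ := interior_subset h2
    obtain ⟨j', hj'k, hj'⟩ := interior_subset h3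
    exact hj'k (hj'.unique (hCS hz) hj)

omit [IsManifold (𝓡 n) ∞ N] in
/-- Near a point of a submanifold, the submanifold is contained in the component of the point. -/
theorem HasCodimAt.eventually_mem_component {S : Set N} {y : N} {k : ℕ} (hyS : y ∈ S)
    (h : HasCodimAt (n := n) S y k) : ∀ᶠ z in 𝓝 y, z ∈ S → z ∈ connectedComponentIn S y := by
  obtain ⟨e, -, hy, W, -, hW⟩ := h
  obtain ⟨r, hr, hball⟩ := Metric.isOpen_iff.1 e.open_target (e y) (e.map_source hy)
  have hpre : IsPreconnected (e.symm '' (Metric.ball (e y) r ∩ (W : Set (Coord n)))) := by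
    refine IsPreconnected.image ?_ _ (e.continuousOn_symm.mono fun v hv => hball hv.1)
    exact ((convex_ball (e y) r).inter W.convex).isPreconnected
  have hsub : e.symm '' (Metric.ball (e y) r ∩ (W : Set (Coord n))) ⊆ S := by
    rintro _ ⟨v, ⟨hv, hvW⟩, rfl⟩
    rw [hW _ (e.map_target (hball hv)), e.right_inv (hball hv)]
    exact hvW
  have hmem : ∀ z ∈ e.source, z ∈ S → e z ∈ Metric.ball (e y) r →
      z ∈ e.symm '' (Metric.ball (e y) r ∩ (W : Set (Coord n))) := fun z hz hzS hzb =>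
    ⟨e z, ⟨hzb, (hW z hz).1 hzS⟩, e.left_inv hz⟩
  have hcomp := hpre.subset_connectedComponentIn
    (hmem y hy hyS (Metric.mem_ball_self hr)) hsub
  filter_upwards [e.open_source.mem_nhds hy,
    (e.continuousAt hy).preimage_mem_nhds (Metric.ball_mem_nhds (e y) hr)] with z h1 h2 h3
  exact hcomp (hmem z h1 h3 h2)

omit [IsManifold (𝓡 n) ∞ N] in
theorem eventually_mem_component_iff {S : Set N} (hS : ∀ y ∈ S, ∃ k, HasCodimAt (n := n) S y k)
    {x y : N} (hy : y ∈ connectedComponentIn S x) :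
    ∀ᶠ z in 𝓝 y, z ∈ S ↔ z ∈ connectedComponentIn S x := by
  have hyS := connectedComponentIn_subset S x hy
  obtain ⟨k, hk⟩ := hS y hyS
  filter_upwards [hk.eventually_mem_component hyS] with z hz
  rw [connectedComponentIn_eq hy]
  exact ⟨hz, fun h => connectedComponentIn_subset S y h⟩

omit [IsManifold (𝓡 n) ∞ N] in
/-- A closed submanifold of a connected manifold with codimension zero somewhere is everything. -/
theorem eq_univ_of_hasCodimAt_zero [ConnectedSpace N] {S : Set N} (hclosed : IsClosed S)
    (hS : ∀ y ∈ S, ∃ k, HasCodimAt (n := n) S y k) {x : N}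
    (h0 : HasCodimAt (n := n) S x 0) : S = Set.univ := by
  have hint : ∀ {y : N} {e : OpenPartialHomeomorph N (Coord n)} (_ : y ∈ e.source)
      {W : Submodule ℝ (Coord n)} (_ : ∀ z ∈ e.source, z ∈ S ↔ e z ∈ W) (_ : W = ⊤),
      y ∈ interior S := by
    intro y e hy W hW hWt
    refine mem_interior.2 ⟨e.source, fun z hz => (hW z hz).2 (by rw [hWt]; trivial),
      e.open_source, hy⟩
  -- At a limit point of the interior, the model subspace contains a nonempty open set and is
  -- therefore all of `ℝⁿ`.
  have hclopen : IsClopen (interior S) := by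
    refine ⟨isClosed_of_closure_subset fun y hy => ?_, isOpen_interior⟩
    have hyS : y ∈ S := closure_minimal interior_subset hclosed hy
    obtain ⟨k, e, -, hye, W, -, hW⟩ := hS y hyS
    obtain ⟨z, hze, hz⟩ := mem_closure_iff.1 hy e.source e.open_source hye
    refine hint hye hW (W.eq_top_of_nonempty_interior' ?_)
    have hopen : IsOpen (e '' (e.source ∩ interior S)) :=
      e.isOpen_image_of_subset_source (e.open_source.inter isOpen_interior) Set.inter_subset_left
    refine ⟨e z, mem_interior.2 ⟨_, ?_, hopen, ⟨z, ⟨hze, hz⟩, rfl⟩⟩⟩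
    rintro _ ⟨w, ⟨hw, hwS⟩, rfl⟩
    exact (hW w hw).1 (interior_subset hwS)
  obtain ⟨e, -, hxe, W, hWn, hW⟩ := h0
  have hWt : W = ⊤ := Submodule.eq_top_of_finrank_eq (by simpa using hWn)
  exact Set.univ_subset_iff.1
    ((hclopen.eq_univ ⟨x, hint hxe hW hWt⟩).symm.subset.trans interior_subset)

end Codimension

/-! ### Isotropy representation and Bochner linearization -/

section Linearization

open Filter Topology

variable {n : ℕ} {N : Type*} [TopologicalSpace N] [ChartedSpace (Coord n) N]
  [IsManifold (𝓡 n) ∞ N] {G : Type*} [Group G] [MulAction G N]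

/-- The action of `t`, read in the preferred chart at `y`. -/
def actionInChart (y : N) (t : G) (v : Coord n) : Coord n :=
  chartAt (Coord n) y (t • (chartAt (Coord n) y).symm v)

theorem contDiffAt_actionInChart {t : G} (ht : ContMDiff (𝓡 n) (𝓡 n) ∞ fun p : N => t • p)
    {y : N} {v : Coord n} (hv : v ∈ (chartAt (Coord n) y).target)
    (htv : t • (chartAt (Coord n) y).symm v ∈ (chartAt (Coord n) y).source) :
    ContDiffAt ℝ ∞ (actionInChart y t) v := by
  have hy := IsManifold.chart_mem_maximalAtlas (I := 𝓡 n) (n := ∞) y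
  refine contMDiffAt_iff_contDiffAt.1 ?_
  exact (contMDiffAt_of_mem_maximalAtlas hy htv).comp v
    ((ht _).comp v (contMDiffAt_symm_of_mem_maximalAtlas hy hv))

/-- The differential at `y` of the action of `t`, in the preferred chart at `y`. -/
def actionDeriv (y : N) (t : G) : Coord n →L[ℝ] Coord n :=
  fderiv ℝ (actionInChart y t) (chartAt (Coord n) y y)

theorem hasFDerivAt_actionInChart {t : G} (ht : ContMDiff (𝓡 n) (𝓡 n) ∞ fun p : N => t • p)
    {y : N} (hy : t • y = y) :
    HasFDerivAt (actionInChart y t) (actionDeriv y t) (chartAt (Coord n) y y) := by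
  refine ((contDiffAt_actionInChart ht (mem_chart_target _ y) ?_).differentiableAt
    (by simp)).hasFDerivAt
  rw [(chartAt (Coord n) y).left_inv (mem_chart_source _ y), hy]
  exact mem_chart_source _ y

omit [IsManifold (𝓡 n) ∞ N] in
theorem actionInChart_self {t : G} {y : N} (hy : t • y = y) :
    actionInChart y t (chartAt (Coord n) y y) = chartAt (Coord n) y y := by
  rw [actionInChart, (chartAt (Coord n) y).left_inv (mem_chart_source _ y), hy]

omit [IsManifold (𝓡 n) ∞ N] in
theorem actionDeriv_one (y : N) : actionDeriv y (1 : G) = ContinuousLinearMap.id ℝ (Coord n) := by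
  refine HasFDerivAt.fderiv ((hasFDerivAt_id _).congr_of_eventuallyEq ?_)
  filter_upwards [(chartAt (Coord n) y).open_target.mem_nhds (mem_chart_target _ y)] with v hv
  rw [actionInChart, one_smul, (chartAt (Coord n) y).right_inv hv, id]

theorem actionDeriv_mul {t t' : G} (ht : ContMDiff (𝓡 n) (𝓡 n) ∞ fun p : N => t • p)
    (ht' : ContMDiff (𝓡 n) (𝓡 n) ∞ fun p : N => t' • p) {y : N} (hy : t • y = y)
    (hy' : t' • y = y) :
    actionDeriv (n := n) y (t * t') = (actionDeriv y t).comp (actionDeriv y t') := by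
  have h1 := hasFDerivAt_actionInChart (n := n) ht hy
  rw [← actionInChart_self (n := n) hy'] at h1
  refine HasFDerivAt.fderiv ((h1.comp _ (hasFDerivAt_actionInChart ht' hy')).congr_of_eventuallyEq ?_)
  set ψ := chartAt (Coord n) y
  have hcont : ContinuousAt (fun v => t' • ψ.symm v) (ψ y) :=
    ht'.continuous.continuousAt.comp (ψ.continuousAt_symm (mem_chart_target _ y))
  filter_upwards [hcont.preimage_mem_nhds (ψ.open_source.mem_nhds (by
    rw [ψ.left_inv (mem_chart_source _ y), hy']
    exact mem_chart_source _ y))] with v hv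
  change ψ ((t * t') • ψ.symm v) = ψ (t • ψ.symm (ψ (t' • ψ.symm v)))
  rw [ψ.left_inv hv, mul_smul]

/-- The isotropy representation at a fixed point of a smooth action. -/
def isotropyRep (y : N) (hG : ∀ t : G, ContMDiff (𝓡 n) (𝓡 n) ∞ fun p : N => t • p)
    (hy : ∀ t : G, t • y = y) : G →* Module.End ℝ (Coord n) where
  toFun t := (actionDeriv y t).toLinearMap
  map_one' := by rw [actionDeriv_one]; rfl
  map_mul' t t' := by rw [actionDeriv_mul (hG t) (hG t') (hy t) (hy t')]; rfl

/-- Bochner linearization: near a fixed point `y` of a finite group of diffeomorphisms the fixed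
point set is a submanifold, whose tangent space at `y` is the fixed space of the differentials. -/
theorem hasCodimAt_fixedPoints {F : Type*} [Group F] [Fintype F] (φ : F →* G)
    (hF : ∀ f : F, ContMDiff (𝓡 n) (𝓡 n) ∞ fun p : N => φ f • p) {y : N}
    (hy : ∀ f : F, φ f • y = y) {W : Submodule ℝ (Coord n)}
    (hW : ∀ v, v ∈ W ↔ ∀ f : F, actionDeriv y (φ f) v = v) {k : ℕ}
    (hk : Module.finrank ℝ W + k = n) :
    HasCodimAt (n := n) {z : N | ∀ f : F, φ f • z = z} y k := by
  classical
  set ψ := chartAt (Coord n) y with hψ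
  let A : F → Coord n →L[ℝ] Coord n := fun f => actionDeriv y (φ f)
  have hAmul : ∀ f f', A (f * f') = (A f).comp (A f') := fun f f' => by
    change actionDeriv y (φ (f * f')) = _
    rw [map_mul, actionDeriv_mul (hF f) (hF f') (hy f) (hy f')]
  have hAone : A 1 = ContinuousLinearMap.id ℝ (Coord n) := by
    change actionDeriv y (φ 1) = _
    rw [map_one, actionDeriv_one]
  -- Averaging the chart over the finite group makes it intertwine the action with the differentials
  -- `A f` (`hΦ`).
  let Φ : N → Coord n := fun z => (Fintype.card F : ℝ)⁻¹ • ∑ f, A f⁻¹ (ψ (φ f • z))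
  have hΦ : ∀ f z, Φ (φ f • z) = A f (Φ z) := by
    intro f z
    simp only [Φ, map_smul, map_sum]
    congr 1
    refine Fintype.sum_equiv (Equiv.mulRight f) _ _ fun f' => ?_
    rw [Equiv.coe_mulRight, mul_inv_rev, hAmul, ← mul_smul, ← map_mul,
      ← ContinuousLinearMap.comp_apply, ← ContinuousLinearMap.comp_assoc, ← hAmul,
      mul_inv_cancel, hAone, ContinuousLinearMap.id_comp]
  let g : Coord n → Coord n := fun v => Φ (ψ.symm v)
  have hg : g = fun v => (Fintype.card F : ℝ)⁻¹ • ∑ f, A f⁻¹ (actionInChart y (φ f) v) := rfl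
  let O : Set N := ⋂ f : F, {z | φ f • z ∈ ψ.source}
  have hO : IsOpen O := isOpen_iInter_of_finite fun f =>
    ψ.open_source.preimage (hF f).continuous
  let D : Set (Coord n) := ψ.target ∩ ψ.symm ⁻¹' O
  have hD : IsOpen D := ψ.isOpen_inter_preimage_symm hO
  have hyO : y ∈ O := Set.mem_iInter.2 fun f => by
    change φ f • y ∈ ψ.source
    rw [hy f]
    exact mem_chart_source _ y
  have huD : ψ y ∈ D := ⟨mem_chart_target _ y, by
    rw [Set.mem_preimage, ψ.left_inv (mem_chart_source _ y)]; exact hyO⟩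
  have hgD : ∀ v ∈ D, ContDiffAt ℝ ∞ g v := by
    intro v hv
    rw [hg]
    refine ContDiffAt.const_smul (f := fun v => ∑ f, A f⁻¹ (actionInChart y (φ f) v)) _
      (ContDiffAt.sum fun f _ => ?_)
    exact (A f⁻¹).contDiff.contDiffAt.comp v
      (contDiffAt_actionInChart (hF f) hv.1 (Set.mem_iInter.1 hv.2 f))
  -- The derivative is the average of `A f⁻¹ ∘ A f = id`, so the inverse function theorem applies to
  -- `g`.
  have hgu : HasFDerivAt g (ContinuousLinearMap.id ℝ (Coord n)) (ψ y) := by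
    have h1 : HasFDerivAt g ((Fintype.card F : ℝ)⁻¹ • ∑ f, (A f⁻¹).comp (A f)) (ψ y) := by
      rw [hg]
      refine (HasFDerivAt.fun_sum fun f _ => ?_).fun_const_smul _
      exact (A f⁻¹).hasFDerivAt.comp _ (hasFDerivAt_actionInChart (hF f) (hy f))
    convert h1 using 1
    simp only [← hAmul, inv_mul_cancel, hAone, Finset.sum_const, Finset.card_univ]
    rw [← Nat.cast_smul_eq_nsmul ℝ, smul_smul, inv_mul_cancel₀ (by simp), one_smul]
  let p := (hgD _ huD).toOpenPartialHomeomorph g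
    (f' := ContinuousLinearEquiv.refl ℝ (Coord n)) hgu (by simp)
  have hpu : ψ y ∈ p.source := (hgD _ huD).mem_toOpenPartialHomeomorph_source _ _
  have hpcoe : ∀ v, p v = g v := fun v => rfl
  -- Invertibility of the derivative on all of `D'` makes the local inverse smooth everywhere, not
  -- only at the image of `y`.
  let D' : Set (Coord n) := D ∩ fderiv ℝ g ⁻¹' {L | IsUnit L}
  have hD' : IsOpen D' :=
    (ContDiffOn.continuousOn_fderiv_of_isOpen (fun v hv => (hgD v hv).contDiffWithinAt) hD
      (by simp)).isOpen_inter_preimage hD Units.isOpen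
  have huD' : ψ y ∈ D' := ⟨huD, by
    rw [Set.mem_preimage, hgu.fderiv]
    exact isUnit_one⟩
  let q := p.restr D'
  have hqs : q.source = p.source ∩ D' := p.restr_source' D' hD'
  have hqsymm : ∀ v ∈ q.target, ContDiffAt ℝ ∞ q.symm v := by
    intro v hv
    have h1 : q.symm v ∈ D' := (hqs ▸ q.map_target hv).2
    obtain ⟨L, hL⟩ := h1.2
    refine q.contDiffAt_symm (f₀' := ContinuousLinearEquiv.unitsEquiv ℝ (Coord n) L) hv ?_
      (hgD _ h1.1)
    have h2 := ((hgD _ h1.1).differentiableAt (by simp)).hasFDerivAt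
    rw [← hL] at h2
    exact h2
  let e := ψ.trans q
  have hes : e.source = ψ.source ∩ ψ ⁻¹' q.source := ψ.trans_source q
  have het : e.target = q.target ∩ q.symm ⁻¹' ψ.target := ψ.trans_target q
  have hye : y ∈ e.source := by
    rw [hes]
    exact ⟨mem_chart_source _ y, by rw [Set.mem_preimage, hqs]; exact ⟨hpu, huD'⟩⟩
  have heΦ : ∀ z ∈ e.source, e z = Φ z := by
    intro z hz
    rw [hes] at hz
    change Φ (ψ.symm (ψ z)) = Φ z
    rw [ψ.left_inv hz.1]
  have hψm := IsManifold.chart_mem_maximalAtlas (I := 𝓡 n) (n := ∞) y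
  have hem : e ∈ IsManifold.maximalAtlas (𝓡 n) ∞ N := by
    refine e.mem_maximalAtlas_of_contMDiffOn (fun z hz => ?_) fun v hv => ?_
    · rw [hes] at hz
      refine ContMDiffAt.contMDiffWithinAt ?_
      have h1 : ψ z ∈ D := (hqs ▸ hz.2 : ψ z ∈ p.source ∩ D').2.1
      exact (contMDiffAt_iff_contDiffAt.2 (hgD _ h1)).comp z
        (contMDiffAt_of_mem_maximalAtlas hψm hz.1)
    · rw [het] at hv
      refine ContMDiffAt.contMDiffWithinAt ?_
      exact (contMDiffAt_symm_of_mem_maximalAtlas hψm hv.2).comp v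
        (contMDiffAt_iff_contDiffAt.2 (hqsymm v hv.1))
  -- On `O'` the whole orbit stays in the chart, so injectivity of `e` turns `φ f • z = z` into a
  -- linear equation for `e z`.
  let O' : Set N := ⋂ f : F, {z | φ f • z ∈ e.source}
  have hO' : IsOpen O' := isOpen_iInter_of_finite fun f =>
    e.open_source.preimage (hF f).continuous
  refine ⟨e.restr O', restr_mem_maximalAtlas _ hem hO', ?_, W, hk, fun z hz => ?_⟩
  · rw [e.restr_source' O' hO']
    refine ⟨hye, Set.mem_iInter.2 fun f => ?_⟩
    change φ f • y ∈ e.source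
    rwa [hy f]
  · rw [e.restr_source' O' hO'] at hz
    have hfz : ∀ f, φ f • z ∈ e.source := fun f => Set.mem_iInter.1 hz.2 f
    change (∀ f, φ f • z = z) ↔ e z ∈ W
    rw [hW, heΦ z hz.1]
    refine forall_congr' fun f => ?_
    rw [← (e.injOn.eq_iff (hfz f) hz.1), heΦ _ (hfz f), heΦ z hz.1, hΦ]

end Linearization

/-! ### Fixed point sets of involutions in terms of the code -/

section Involutions

open Filter Topology

variable {n s : ℕ} {N : Type*} [TopologicalSpace N] [MulAction (Torus s) N]

/-- The common fixed points of a set of involutions of the torus. -/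
def involutionFixedSet (N : Type*) [MulAction (Torus s) N] (Q : Finset (Fin s → ℤˣ)) : Set N :=
  {z | ∀ a ∈ Q, involution s a • z = z}

omit [TopologicalSpace N] in
theorem involutionFixedSet_singleton (a : Fin s → ℤˣ) :
    involutionFixedSet N {a} = {z | involution s a • z = z} := by
  simp [involutionFixedSet]

omit [TopologicalSpace N] in
-- Replacing `Q` by the finite group it generates makes averaging available.
theorem involutionFixedSet_closure (Q : Finset (Fin s → ℤˣ)) :
    involutionFixedSet N Q = {z | ∀ f : Subgroup.closure (Q : Set (Fin s → ℤˣ)),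
      (involution s).comp (Subgroup.subtype _) f • z = z} := by
  ext z
  constructor
  · rintro hz ⟨f, hf⟩
    have h1 : Subgroup.closure (Q : Set (Fin s → ℤˣ))
        ≤ (MulAction.stabilizer (Torus s) z).comap (involution s) :=
      (Subgroup.closure_le _).2 hz
    exact h1 hf
  · intro hz a ha
    exact hz ⟨a, Subgroup.subset_closure ha⟩

variable [ChartedSpace (Coord n) N] [IsManifold (𝓡 n) ∞ N]

/-- The torus may move `y`, but the finite group generated by `Q` fixes it, which is enough for
linearization. -/
theorem exists_hasCodimAt_involutionFixedSet
    (hT : ∀ t : Torus s, ContMDiff (𝓡 n) (𝓡 n) ∞ fun p : N => t • p)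
    (Q : Finset (Fin s → ℤˣ)) {y : N} (hy : y ∈ involutionFixedSet N Q) :
    ∃ k, HasCodimAt (n := n) (involutionFixedSet N Q) y k := by
  classical
  rw [involutionFixedSet_closure] at hy ⊢
  set φ := (involution s).comp (Subgroup.subtype (Subgroup.closure (Q : Set (Fin s → ℤˣ))))
  let W : Submodule ℝ (Coord n) :=
    ⨅ f, LinearMap.ker ((actionDeriv (n := n) y (φ f)).toLinearMap - LinearMap.id)
  have hWn : Module.finrank ℝ W ≤ n := by simpa using W.finrank_le
  refine ⟨n - Module.finrank ℝ W, ?_⟩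
  refine hasCodimAt_fixedPoints φ (fun f => hT (φ f)) hy (W := W) (fun v => ?_) (by omega)
  simp [W, Submodule.mem_iInf, sub_eq_zero]

/-- The code of a torus action at a fixed point computes the codimensions of the fixed point sets
of involutions. -/
theorem exists_isotropy_code (hT : ∀ t : Torus s, ContMDiff (𝓡 n) (𝓡 n) ∞ fun p : N => t • p)
    {x : N} (hx : ∀ t : Torus s, t • x = x) :
    ∃ (k : ℕ) (e : Fin k → (Fin s → ℤˣ) →* ℤˣ), 2 * k ≤ n ∧ ∀ Q : Finset (Fin s → ℤˣ),
      HasCodimAt (n := n) (involutionFixedSet N Q) x (2 * (Q.biUnion (wordSupport e)).card) := by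
  classical
  obtain ⟨k, e, hk, hQ⟩ := exists_code (isotropyRep (n := n) x hT hx)
  rw [finrank_euclideanSpace_fin] at hk
  refine ⟨k, e, hk, fun Q => ?_⟩
  have h1 := hQ Q
  rw [finrank_euclideanSpace_fin] at h1
  rw [involutionFixedSet_closure]
  refine hasCodimAt_fixedPoints _ (fun f => hT _) (fun f => hx _)
    (W := weightSpace ((isotropyRep (n := n) x hT hx).comp (involution s)) Q 1) (fun v => ?_) ?_
  · constructor
    · rintro hv ⟨f, hf⟩
      have h2 : ∀ g ∈ Subgroup.closure (Q : Set (Fin s → ℤˣ)),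
          isotropyRep (n := n) x hT hx (involution s g) v = v := by
        intro g hg
        induction hg using Subgroup.closure_induction with
        | mem a ha => simpa using hv a ha
        | one => simp
        | mul a b _ _ ha hb => rw [map_mul, map_mul, Module.End.mul_apply, hb, ha]
        | inv a _ ha =>
          rw [inv_eq_of_mul_eq_one_left (signs_mul_self a)]
          exact ha
      exact h2 f hf
    · intro hv a ha
      have h2 := hv ⟨a, Subgroup.subset_closure ha⟩
      simpa using! h2
  · refine Eq.trans ?_ h1
    congr 3
    ext j
    simp [mem_wordSupport]

theorem hasCodim_component {S : Set N} (hS : ∀ y ∈ S, ∃ k, HasCodimAt (n := n) S y k) {x : N}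
    (hx : x ∈ S) {k : ℕ} (hk : HasCodimAt (n := n) S x k) :
    HasCodim (n := n) (connectedComponentIn S x) k := fun _ hy =>
  (HasCodimAt.of_isPreconnected hS isPreconnected_connectedComponentIn
    (connectedComponentIn_subset S x) (mem_connectedComponentIn hx) hk hy).congr
    (eventually_mem_component_iff hS hy)

/-- For an effective action of the torus on a connected manifold the code is faithful. -/
theorem wordSupport_nonempty [T2Space N] [ConnectedSpace N] [FaithfulSMul (Torus s) N]
    (hT : ∀ t : Torus s, ContMDiff (𝓡 n) (𝓡 n) ∞ fun p : N => t • p) {x : N} {k : ℕ}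
    {e : Fin k → (Fin s → ℤˣ) →* ℤˣ}
    (hcode : ∀ Q : Finset (Fin s → ℤˣ),
      HasCodimAt (n := n) (involutionFixedSet N Q) x (2 * (Q.biUnion (wordSupport e)).card))
    {a : Fin s → ℤˣ} (ha : a ≠ 1) : (wordSupport e a).Nonempty := by
  rw [Finset.nonempty_iff_ne_empty]
  intro h0
  have h1 := hcode {a}
  rw [Finset.singleton_biUnion, h0, Finset.card_empty, mul_zero] at h1
  have hclosed : IsClosed (involutionFixedSet N {a}) := by
    rw [involutionFixedSet_singleton]
    exact isClosed_eq (hT _).continuous continuous_id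
  have h2 := eq_univ_of_hasCodimAt_zero hclosed
    (fun y hy => exists_hasCodimAt_involutionFixedSet hT _ hy) h1
  refine ha (involution_injective s ?_)
  rw [map_one]
  refine FaithfulSMul.eq_of_smul_eq_smul (α := N) fun z => ?_
  have h3 : z ∈ involutionFixedSet N {a} := h2 ▸ Set.mem_univ z
  rw [one_smul]
  exact h3 a (Finset.mem_singleton_self a)

/-- A faithful code embeds `{±1}^s` into `{±1}^k`. -/
theorem length_le_of_faithful {k : ℕ} {e : Fin k → (Fin s → ℤˣ) →* ℤˣ}
    (h : ∀ a, a ≠ 1 → (wordSupport e a).Nonempty) : s ≤ k := by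
  have hinj : Function.Injective (MonoidHom.pi e) := by
    rw [injective_iff_map_eq_one]
    intro a ha
    by_contra h1
    obtain ⟨j, hj⟩ := h a h1
    rw [mem_wordSupport, show e j a = 1 from congrFun ha j] at hj
    exact absurd hj (by decide)
  have h1 := Fintype.card_le_of_injective _ hinj
  simp only [Fintype.card_pi, Fintype.card_units_int, Finset.prod_const, Finset.card_univ,
    Fintype.card_fin] at h1
  exact (Nat.pow_le_pow_iff_right one_lt_two).1 h1

/-- The codimension is twice the weight, so even weight gives divisibility by 4, and the strict
integer bound says `2w ≤ (n - c)/2`. -/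
theorem isSmallInvolution_of_code
    (hT : ∀ t : Torus s, ContMDiff (𝓡 n) (𝓡 n) ∞ fun p : N => t • p)
    {x : N} (hx : ∀ t : Torus s, t • x = x) {k : ℕ}
    {e : Fin k → (Fin s → ℤˣ) →* ℤˣ}
    (hcode : ∀ Q : Finset (Fin s → ℤˣ),
      HasCodimAt (n := n) (involutionFixedSet N Q) x (2 * (Q.biUnion (wordSupport e)).card))
    {c : ℕ} (hcn : c ≤ n) {b : Fin s → ℤˣ} (hb : b ≠ 1) (hpos : (wordSupport e b).Nonempty)
    (heven : Even (wordSupport e b).card) (hlt : 4 * (wordSupport e b).card < n - c + 1) :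
    IsSmallInvolution (n := n) c x (involution s b) (2 * (wordSupport e b).card) := by
  refine ⟨orderOf_involution hb, ?_, ?_, ?_, ?_⟩
  · have h1 := hasCodim_component (fun y hy => exists_hasCodimAt_involutionFixedSet hT {b} hy)
      (fun _ _ => hx _) (hcode {b})
    rwa [Finset.singleton_biUnion, involutionFixedSet_singleton] at h1
  · obtain ⟨r, hr⟩ := heven
    exact ⟨r, by omega⟩
  · have := hpos.card_pos
    omega
  · have h1 : 4 * (wordSupport e b).card + c ≤ n := by omega
    have h2 : 4 * ((wordSupport e b).card : ℝ) + c ≤ n := by exact_mod_cast h1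
    push_cast
    linarith

end Involutions

/-! ### Numerical estimates -/

section Numerics

theorem parity_eq (n : ℕ) : parity n = ((n % 2 : ℕ) : ℝ) := by
  unfold parity
  split_ifs with h
  · rw [Nat.even_iff.1 h]; simp
  · rw [Nat.not_even_iff.1 h]; simp

theorem le_two_pow_of_logb_le {a M : ℕ} (ha : 0 < a) (h : Real.logb 2 a ≤ M) : a ≤ 2 ^ M := by
  rw [Real.logb_le_iff_le_rpow one_lt_two (by exact_mod_cast ha), Real.rpow_natCast] at h
  exact_mod_cast h

/-- Doubling the inequality before exponentiating clears the half-integer `c / 2`. -/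
theorem four_pow_bound_of_two_log_le {n c s : ℕ} (hn : 0 < n)
    (h : 2 * Real.logb 2 n + (c : ℝ) / 2 - 1 - parity n ≤ (s : ℝ)) :
    n ^ 4 * 2 ^ c ≤ 4 ^ (s + 1 + n % 2) := by
  rw [show (4 : ℕ) = 2 ^ 2 by norm_num, ← pow_mul]
  refine le_two_pow_of_logb_le (by positivity) ?_
  push_cast
  have hn' : (n : ℝ) ≠ 0 := by positivity
  rw [parity_eq] at h
  rw [Real.logb_mul (by positivity) (by positivity), Real.logb_pow, Real.logb_pow,
    Real.logb_self_eq_one one_lt_two]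
  push_cast at h ⊢
  linarith

theorem four_pow_bound_of_log_le {n c s : ℕ} (hn : 0 < n)
    (h : Real.logb 2 n + (c : ℝ) / 2 + 1 + Real.logb 2 3 - parity n ≤ (s : ℝ)) :
    36 * n ^ 2 * 2 ^ c ≤ 4 ^ (s + n % 2) := by
  rw [show (4 : ℕ) ^ (s + n % 2) = 2 ^ (2 * (s + n % 2)) by rw [pow_mul]; norm_num]
  refine le_two_pow_of_logb_le (by positivity) ?_
  have hn' : (n : ℝ) ≠ 0 := by positivity
  rw [parity_eq] at h
  rw [show ((36 * n ^ 2 * 2 ^ c : ℕ) : ℝ) = (2 ^ 2 * 3 ^ 2) * (n : ℝ) ^ 2 * 2 ^ c by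
    push_cast; ring]
  rw [Real.logb_mul (by positivity) (by positivity), Real.logb_mul (by positivity) (by positivity),
    Real.logb_mul (by positivity) (by positivity), Real.logb_pow, Real.logb_pow, Real.logb_pow,
    Real.logb_pow, Real.logb_self_eq_one one_lt_two]
  push_cast at h ⊢
  linarith

theorem lt_of_sq_four_pow_lt {D m s : ℕ} (h : D ^ 2 * 4 ^ m < 4 * 4 ^ s) :
    D * 2 ^ m < 2 * 2 ^ s := by
  refine lt_of_pow_lt_pow_left₀ 2 (by positivity) ?_
  rw [mul_pow, mul_pow, ← pow_mul, ← pow_mul, mul_comm m, mul_comm s, pow_mul, pow_mul]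
  exact h

/-- The choice `t = ⌊(c + 2 - δ)/2⌋` makes the gap `D + 2t - 2k` at least 2; for odd `n` this uses
`2k ≤ n - 1`. -/
theorem card_bound {n c s k : ℕ} (hcn : c ≤ n) (hc : 2 ≤ c) (hk : 2 * k ≤ n) (q : ℕ)
    (h : (n - c + 1) ^ 2 * 4 ^ (q + (c + 2 - n % 2) / 2) < 4 * 4 ^ s) :
    2 * k < n - c + 1 + 2 * ((c + 2 - n % 2) / 2) ∧
      (n - c + 1) * 2 ^ (q + (c + 2 - n % 2) / 2)
        < (n - c + 1 + 2 * ((c + 2 - n % 2) / 2) - 2 * k) * 2 ^ s := by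
  refine ⟨by omega, (lt_of_sq_four_pow_lt h).trans_le (Nat.mul_le_mul_right _ (by omega))⟩

theorem four_pow_half_le {c δ : ℕ} (hδ : δ ≤ 1) :
    2 ^ δ * 4 ^ ((c + 2 - δ) / 2) ≤ 4 * 2 ^ c := by
  rw [show (4 : ℕ) ^ ((c + 2 - δ) / 2) = 2 ^ (2 * ((c + 2 - δ) / 2)) by rw [pow_mul]; norm_num,
    show 4 * 2 ^ c = 2 ^ (c + 2) by ring, ← pow_add]
  exact Nat.pow_le_pow_right (by norm_num) (by omega)

/-- The numerical input for the first part. -/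
theorem bounds_of_two_log_le {n c s k : ℕ} (hcn : c ≤ n) (hc : 2 ≤ c) (hk : 2 * k ≤ n)
    (hs : s ≤ k) (h : n ^ 4 * 2 ^ c ≤ 4 ^ (s + 1 + n % 2)) :
    (c + 2 - n % 2) / 2 ≤ k ∧
      (n - c + 1) ^ 2 * 4 ^ (1 + (c + 2 - n % 2) / 2) < 4 * 4 ^ s := by
  have hδ : n % 2 = 0 ∨ n % 2 = 1 := by omega
  have hle := four_pow_half_le (c := c) (δ := n % 2) (by omega)
  have h2c : 0 < 2 ^ c := by positivity
  constructor
  · by_contra hlt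
    have h1 : 4 ^ s ≤ 2 ^ c := by
      rw [show (4 : ℕ) ^ s = 2 ^ (2 * s) by rw [pow_mul]; norm_num]
      exact Nat.pow_le_pow_right (by norm_num) (by omega)
    have h2 : 2 ^ 4 ≤ n ^ 4 := Nat.pow_le_pow_left (by omega) 4
    rcases hδ with hδ | hδ
    · rw [hδ] at h
      have : 4 ^ (s + 1 + 0) = 4 * 4 ^ s := by ring
      nlinarith
    · have h3 : 3 ^ 4 ≤ n ^ 4 := Nat.pow_le_pow_left (by omega) 4
      rw [hδ] at h
      have : 4 ^ (s + 1 + 1) = 16 * 4 ^ s := by ring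
      nlinarith
  · have hD : n - c + 1 ≤ n - 1 := by omega
    have hD2 : (n - c + 1) ^ 2 ≤ (n - 1) ^ 2 := Nat.pow_le_pow_left hD 2
    -- The polynomial comparisons `16(n-1)² < n⁴` (even) and `32(n-1)² < n⁴` (odd) fail for `n = 2,
    -- 3`; there `s ≤ k ≤ 1` contradicts the lower bound on `s`.
    have hsmall : n = 2 ∨ n = 3 ∨ 4 ≤ n := by omega
    rcases hsmall with rfl | rfl | hn
    · have hs1 : s ≤ 1 := by omega
      have h4 : 4 ^ (s + 1 + 2 % 2) ≤ 4 ^ 2 := Nat.pow_le_pow_right (by norm_num) (by omega)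
      have h5 : 2 ^ 2 ≤ 2 ^ c := Nat.pow_le_pow_right (by norm_num) hc
      omega
    · have hs1 : s ≤ 1 := by omega
      have h4 : 4 ^ (s + 1 + 3 % 2) ≤ 4 ^ 3 := Nat.pow_le_pow_right (by norm_num) (by omega)
      have h5 : 2 ^ 2 ≤ 2 ^ c := Nat.pow_le_pow_right (by norm_num) hc
      omega
    · obtain ⟨r, rfl⟩ : ∃ r, n = r + 4 := ⟨n - 4, by omega⟩
      rw [show r + 4 - 1 = r + 3 by omega] at hD2
      rw [pow_add 4 1]
      set X := 4 ^ ((c + 2 - (r + 4) % 2) / 2)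
      rcases hδ with hδ | hδ
      · rw [hδ] at hle h
        have h6 : 4 ^ (s + 1 + 0) = 4 * 4 ^ s := by ring
        have h7 : 16 * (r + 3) ^ 2 < (r + 4) ^ 4 := by
          nlinarith [Nat.zero_le (r ^ 3), Nat.zero_le (r ^ 4)]
        calc (r + 4 - c + 1) ^ 2 * (4 ^ 1 * X) ≤ (r + 3) ^ 2 * (4 ^ 1 * (4 * 2 ^ c)) :=
              Nat.mul_le_mul hD2 (by omega)
          _ = 16 * (r + 3) ^ 2 * 2 ^ c := by ring
          _ < (r + 4) ^ 4 * 2 ^ c := Nat.mul_lt_mul_of_pos_right h7 h2c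
          _ ≤ 4 * 4 ^ s := by rw [← h6]; exact h
      · rw [hδ] at hle h
        obtain ⟨r, rfl⟩ : ∃ r', r = r' + 1 := ⟨r - 1, by omega⟩
        have h6 : 4 ^ (s + 1 + 1) = 4 * (4 * 4 ^ s) := by ring
        have h7 : 32 * (r + 4) ^ 2 < (r + 5) ^ 4 := by
          nlinarith [Nat.zero_le (r ^ 3), Nat.zero_le (r ^ 4)]
        have h8 : (r + 1 + 4 - c + 1) ^ 2 * X ≤ (r + 4) ^ 2 * (2 * 2 ^ c) :=
          Nat.mul_le_mul hD2 (by omega)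
        have h9 := Nat.mul_lt_mul_of_pos_right h7 h2c
        rw [show r + 1 + 4 = r + 5 by omega] at h h8 ⊢
        nlinarith

/-- The numerical input for the second part. -/
theorem bounds_of_log_le {n c s k : ℕ} (hcn : c ≤ n) (hc : 2 ≤ c)
    (hs : s ≤ k) (h : 36 * n ^ 2 * 2 ^ c ≤ 4 ^ (s + n % 2)) :
    (c + 2 - n % 2) / 2 ≤ k ∧
      (n - c + 1) ^ 2 * 4 ^ (2 + (c + 2 - n % 2) / 2) < 4 * 4 ^ s := by
  have hδ : n % 2 = 0 ∨ n % 2 = 1 := by omega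
  have hle := four_pow_half_le (c := c) (δ := n % 2) (by omega)
  have h2c : 0 < 2 ^ c := by positivity
  have h4s : 36 * n ^ 2 * 2 ^ c ≤ 2 ^ (n % 2) * (2 ^ (n % 2) * 4 ^ s) := by
    refine h.trans (le_of_eq ?_)
    rw [pow_add, show (4 : ℕ) ^ (n % 2) = 2 ^ (n % 2) * 2 ^ (n % 2) by
      rw [← mul_pow]; norm_num]
    ring
  have hn2 : 0 < n ^ 2 := pow_pos (by omega) 2
  constructor
  · by_contra hlt
    have h1 : 4 ^ s ≤ 2 ^ c := by
      rw [show (4 : ℕ) ^ s = 2 ^ (2 * s) by rw [pow_mul]; norm_num]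
      exact Nat.pow_le_pow_right (by norm_num) (by omega)
    rcases hδ with hδ | hδ <;> rw [hδ] at h4s <;> nlinarith
  · have hD2 : (n - c + 1) ^ 2 ≤ n ^ 2 := Nat.pow_le_pow_left (by omega) 2
    rw [pow_add 4 2]
    have h8 := Nat.mul_le_mul hD2 hle
    have h9 : 0 < n ^ 2 * 2 ^ c := by positivity
    -- For odd `n` the comparison is `32 < 36`, that is `log₂ 3 > 3/2`; for even `n` it is `64 <
    -- 144`.
    rcases hδ with hδ | hδ <;> rw [hδ] at h4s h8 ⊢ <;> nlinarith

end Numerics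

/-! ### Fixed components and their intersections -/

section SmallInvolutions

open Filter Topology

variable {n s c : ℕ} {N : Type*} [TopologicalSpace N] [MulAction (Torus s) N]
  [ChartedSpace (Coord n) N] [IsManifold (𝓡 n) ∞ N]
  {x : N} {k : ℕ} {e : Fin k → (Fin s → ℤˣ) →* ℤˣ}

theorem exists_light_signs (hcn : c ≤ n) (hc : 2 ≤ c) (hk : 2 * k ≤ n) {q : ℕ}
    (ψ : Fin q → (Fin s → ℤˣ) →* ℤˣ) {T : Finset (Fin k)} (hT : T.card = (c + 2 - n % 2) / 2)
    (h : (n - c + 1) ^ 2 * 4 ^ (q + (c + 2 - n % 2) / 2) < 4 * 4 ^ s) :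
    ∃ b, b ≠ 1 ∧ (∀ i, ψ i b = 1) ∧ (∀ j ∈ T, e j b = 1) ∧
      4 * (wordSupport e b).card < n - c + 1 := by
  obtain ⟨h1, h2⟩ := card_bound hcn hc hk q h
  rw [← hT] at h1 h2
  refine exists_light_word e ψ T h1 ?_
  simpa using h2

theorem fixedComponent_involution (a : Fin s → ℤˣ) (x : N) :
    fixedComponent (involution s a) x = connectedComponentIn (involutionFixedSet N {a}) x := by
  rw [involutionFixedSet_singleton]; rfl

theorem eventually_mem_fixedComponent_iff
    (hT : ∀ t : Torus s, ContMDiff (𝓡 n) (𝓡 n) ∞ fun p : N => t • p) (a : Fin s → ℤˣ) {y : N}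
    (hy : y ∈ fixedComponent (involution s a) x) :
    ∀ᶠ z in 𝓝 y, involution s a • z = z ↔ z ∈ fixedComponent (involution s a) x := by
  rw [fixedComponent_involution] at hy ⊢
  filter_upwards [eventually_mem_component_iff
    (fun y hy => exists_hasCodimAt_involutionFixedSet hT {a} hy) hy] with z hz
  rw [← hz, involutionFixedSet_singleton]
  rfl

theorem mem_fixedComponent_self (hx : ∀ t : Torus s, t • x = x) (t : Torus s) :
    x ∈ fixedComponent t x := mem_connectedComponentIn (hx t)

/-- The codimension of the fixed component of an involution is twice the weight of its word. -/
theorem eq_two_mul_card_wordSupport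
    (hT : ∀ t : Torus s, ContMDiff (𝓡 n) (𝓡 n) ∞ fun p : N => t • p)
    (hx : ∀ t : Torus s, t • x = x)
    (hcode : ∀ Q : Finset (Fin s → ℤˣ),
      HasCodimAt (n := n) (involutionFixedSet N Q) x (2 * (Q.biUnion (wordSupport e)).card))
    {a : Fin s → ℤˣ} {l : ℕ} (hl : HasCodim (n := n) (fixedComponent (involution s a) x) l) :
    l = 2 * (wordSupport e a).card := by
  have h1 := hcode {a}
  rw [Finset.singleton_biUnion, involutionFixedSet_singleton] at h1
  have hmem := mem_fixedComponent_self hx (involution s a)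
  exact (hl x hmem).unique hmem (h1.congr (eventually_mem_fixedComponent_iff hT a hmem))

/-- An inclusion of fixed components gives an inclusion of supports. -/
theorem wordSupport_subset_of_fixedComponent_subset
    (hT : ∀ t : Torus s, ContMDiff (𝓡 n) (𝓡 n) ∞ fun p : N => t • p)
    (hx : ∀ t : Torus s, t • x = x)
    (hcode : ∀ Q : Finset (Fin s → ℤˣ),
      HasCodimAt (n := n) (involutionFixedSet N Q) x (2 * (Q.biUnion (wordSupport e)).card))
    {a b : Fin s → ℤˣ}
    (h : fixedComponent (involution s b) x ⊆ fixedComponent (involution s a) x) :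
    wordSupport e a ⊆ wordSupport e b := by
  have h1 := hcode {b}
  have h2 := hcode {a, b}
  have ha := eventually_mem_fixedComponent_iff hT a (mem_fixedComponent_self hx _)
  have hb := eventually_mem_fixedComponent_iff hT b (mem_fixedComponent_self hx _)
  -- The inclusion makes the fixed set of `b` agree near `x` with that of `{a, b}`; equal
  -- codimensions then leave no room for `a` outside the support of `b`.
  have h3 := h1.congr (S' := involutionFixedSet N {a, b}) (by
    filter_upwards [ha, hb] with z hza hzb
    simp only [involutionFixedSet, Finset.mem_singleton, Finset.mem_insert, forall_eq_or_imp,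
      forall_eq, Set.mem_ofPred_eq]
    exact ⟨fun hz => ⟨hza.2 (h (hzb.1 hz)), hz⟩, fun hz => hz.2⟩)
  have hmem : x ∈ involutionFixedSet N {a, b} := fun _ _ => hx _
  have h4 := h3.unique hmem h2
  rw [Finset.biUnion_insert, Finset.singleton_biUnion] at h4
  have h5 := Finset.eq_of_subset_of_card_le
    (Finset.subset_union_right (s₁ := wordSupport e a) (s₂ := wordSupport e b)) (by omega)
  rw [h5]
  exact Finset.subset_union_left

/-- Near each point of its component containing `x`, the intersection of two fixed components is a
submanifold of codimension twice the size of the union of the supports. -/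
theorem hasCodimAt_inter_fixedComponent
    (hT : ∀ t : Torus s, ContMDiff (𝓡 n) (𝓡 n) ∞ fun p : N => t • p)
    (hx : ∀ t : Torus s, t • x = x)
    (hcode : ∀ Q : Finset (Fin s → ℤˣ),
      HasCodimAt (n := n) (involutionFixedSet N Q) x (2 * (Q.biUnion (wordSupport e)).card))
    (a b : Fin s → ℤˣ) {y : N}
    (hy : y ∈ connectedComponentIn
      (fixedComponent (involution s a) x ∩ fixedComponent (involution s b) x) x) :
    HasCodimAt (n := n) (fixedComponent (involution s a) x ∩ fixedComponent (involution s b) x) y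
      (2 * (wordSupport e a ∪ wordSupport e b).card) := by
  set S := fixedComponent (involution s a) x ∩ fixedComponent (involution s b) x
  have hev : ∀ z ∈ S, ∀ᶠ w in 𝓝 z, w ∈ involutionFixedSet N {a, b} ↔ w ∈ S := by
    intro z hz
    filter_upwards [eventually_mem_fixedComponent_iff hT a hz.1,
      eventually_mem_fixedComponent_iff hT b hz.2] with w hwa hwb
    simp only [involutionFixedSet, Finset.mem_singleton, Finset.mem_insert, forall_eq_or_imp,
      forall_eq, Set.mem_ofPred_eq, hwa, hwb, S, Set.mem_inter_iff]
  have hxS : x ∈ S := ⟨mem_fixedComponent_self hx _, mem_fixedComponent_self hx _⟩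
  have hx' := (hcode {a, b}).congr (hev x hxS)
  rw [Finset.biUnion_insert, Finset.singleton_biUnion] at hx'
  refine HasCodimAt.of_isPreconnected (fun z hz => ?_) isPreconnected_connectedComponentIn
    (connectedComponentIn_subset S x) (mem_connectedComponentIn hxS) hx' hy
  obtain ⟨j, hj⟩ := exists_hasCodimAt_involutionFixedSet hT {a, b}
    ((hev z hz).self_of_nhds.2 hz)
  exact ⟨j, hj.congr (hev z hz)⟩

end SmallInvolutions

end TorusFixedPoints

end

/-! ### The main theorem -/

theorem mainTheorem8 {n c s : ℕ} (hc : 2 ≤ c) (hcn : c ≤ n)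
    {N : Type*} [TopologicalSpace N] [T2Space N] [SecondCountableTopology N] [ConnectedSpace N]
    [ChartedSpace (TorusFixedPoints.Coord n) N] [IsManifold (𝓡 n) ∞ N]
    (g : TorusFixedPoints.RiemMetric n N)
    (hg : TorusFixedPoints.PositivelyCurved g)
    [MulAction (TorusFixedPoints.Torus s) N] [ContinuousSMul (TorusFixedPoints.Torus s) N]
    [FaithfulSMul (TorusFixedPoints.Torus s) N]
    (hiso : TorusFixedPoints.ActsByIsometries g (TorusFixedPoints.Torus s))
    (x : N) (hx : ∀ t : TorusFixedPoints.Torus s, t • x = x) :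
    (2 * Real.logb 2 n + (c : ℝ) / 2 - 1 - TorusFixedPoints.parity n ≤ (s : ℝ) →
      ∃ (σ : TorusFixedPoints.Torus s) (k : ℕ),
        TorusFixedPoints.IsSmallInvolution (n := n) c x σ k) ∧
    (∀ (σ : TorusFixedPoints.Torus s) (k : ℕ),
      TorusFixedPoints.IsSmallInvolution (n := n) c x σ k →
      (∀ (σ' : TorusFixedPoints.Torus s) (k' : ℕ),
        TorusFixedPoints.IsSmallInvolution (n := n) c x σ' k' → k ≤ k') →
      Real.logb 2 n + (c : ℝ) / 2 + 1 + Real.logb 2 3 - TorusFixedPoints.parity n ≤ (s : ℝ) →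
      ∃ (τ : TorusFixedPoints.Torus s) (l m : ℕ),
        TorusFixedPoints.IsSmallInvolution (n := n) c x τ l ∧
        ¬ TorusFixedPoints.fixedComponent τ x ⊆ TorusFixedPoints.fixedComponent σ x ∧
        4 ∣ m ∧
        ∀ y ∈ connectedComponentIn
            (TorusFixedPoints.fixedComponent σ x ∩ TorusFixedPoints.fixedComponent τ x) x,
          TorusFixedPoints.HasCodimAt (n := n)
            (TorusFixedPoints.fixedComponent σ x ∩ TorusFixedPoints.fixedComponent τ x) y m) := by
  open TorusFixedPoints in
  have hT : ∀ t : Torus s, ContMDiff (𝓡 n) (𝓡 n) ∞ fun p : N => t • p := fun t => (hiso t).1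
  obtain ⟨k, e, hk, hcode⟩ := exists_isotropy_code hT hx
  have hfaithful : ∀ a, a ≠ 1 → (wordSupport e a).Nonempty := fun a ha =>
    wordSupport_nonempty hT hcode ha
  have hsk := length_le_of_faithful hfaithful
  have hn : 0 < n := by omega
  refine ⟨fun h => ?_, fun σ l hσ _ h => ?_⟩
  · obtain ⟨htk, hbound⟩ := bounds_of_two_log_le hcn hc hk hsk (four_pow_bound_of_two_log_le hn h)
    obtain ⟨T, -, hTcard⟩ := Finset.exists_subset_card_eq (s := (Finset.univ : Finset (Fin k)))
      (by simpa using htk)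
    -- The product of all `e j` is the parity of the total weight.
    obtain ⟨b, hb, hψ, -, hlt⟩ := exists_light_signs (e := e) hcn hc hk
      (fun _ : Fin 1 => ∏ j, e j) hTcard hbound
    have heven := even_card_of_prod_sign_eq_one (S := Finset.univ)
      (by simpa [MonoidHom.finsetProd_apply] using hψ 0)
    rw [Finset.univ_inter] at heven
    exact ⟨_, _, isSmallInvolution_of_code hT hx hcode hcn hb (hfaithful b hb) heven hlt⟩
  · obtain ⟨a, ha, rfl⟩ := exists_involution_eq hσ.1
    obtain ⟨-, hcodim, h4l, -, -⟩ := hσ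
    have hl := eq_two_mul_card_wordSupport hT hx hcode hcodim
    have hevena : Even (wordSupport e a).card := by
      rw [Nat.even_iff]
      omega
    obtain ⟨j₀, hj₀⟩ := hfaithful a ha
    obtain ⟨htk, hbound⟩ := bounds_of_log_le hcn hc hsk (four_pow_bound_of_log_le hn h)
    -- The new word must vanish at `j₀`; there is room for `j₀` in `T` because `c ≥ 2` gives `t ≥
    -- 1`.
    obtain ⟨T, hjT, -, hTcard⟩ := Finset.exists_subsuperset_card_eq (Finset.subset_univ {j₀})
      (show ({j₀} : Finset (Fin k)).card ≤ (c + 2 - n % 2) / 2 by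
        rw [Finset.card_singleton]; omega) (by simpa using htk)
    obtain ⟨b, hb, hψ, hTb, hlt⟩ := exists_light_signs (e := e) hcn hc hk
      ![∏ j, e j, ∏ j ∈ wordSupport e a, e j] hTcard hbound
    have heven := even_card_of_prod_sign_eq_one (S := Finset.univ)
      (by simpa [MonoidHom.finsetProd_apply] using hψ 0)
    rw [Finset.univ_inter] at heven
    have hevenab := even_card_of_prod_sign_eq_one (S := wordSupport e a)
      (by simpa [MonoidHom.finsetProd_apply] using hψ 1)
    refine ⟨involution s b, _, _,
      isSmallInvolution_of_code hT hx hcode hcn hb (hfaithful b hb) heven hlt, fun hsub => ?_, ?_,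
      fun y hy => hasCodimAt_inter_fixedComponent hT hx hcode a b hy⟩
    · have h1 := mem_wordSupport.1
        (wordSupport_subset_of_fixedComponent_subset hT hx hcode hsub hj₀)
      rw [hTb j₀ (hjT (Finset.mem_singleton_self j₀))] at h1
      exact absurd h1 (by decide)
    -- Both weights and the overlap are even, hence so is the size of the union, and `m` is twice
    -- it.
    · have h1 := Finset.card_union_add_card_inter (wordSupport e a) (wordSupport e b)
      rw [Nat.even_iff] at hevena heven hevenab
      omega
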